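/- Let $(Y,\omega,J)$ be a Kähler manifold of complex dimension $n+1$ with a nowhere vanishing holomorphic $(n+1)$-form $\Omega$, and let $v:Y\to\mathbb C$ be a holomorphic function with finitely many critical values; let $C\subset\mathbb C$ be the set of its regular values and $Y_c=v^{-1}(c)$. Put $\mathrm{Vert}_p=\ker dv_p$, $\mathrm{Hor}_p=\mathrm{Vert}_p^{\perp_\omega}$; for $c\in C$ let $\omega_c=\omega|_{Y_c}$ and let $\Omega_c$ be the residue $n$-form on $Y_c$, i.e. $\Omega_c(u_1,\dots,u_n)=\Omega(u_1,\dots,u_n,w)$ whenever $dv(w)=1$. A fibered Lagrangian $L$ is the embedded submanifold of $v^{-1}(C)$ swept out by a Lagrangian submanifold $\ell$ of $(Y_{\gamma(0)},\omega_{\gamma(0)})$ under symplectic parallel transport along a smooth embedded curve $\gamma:\mathbb R\to C$, that is, by the horizontal lifts of $\gamma$ (assumed to exist for all times) through the points of $\ell$. Write $L_c=L\cap Y_c$ and $v(L)=\gamma(\mathbb R)$. In a Kähler manifold of dimension $m$ with nowhere vanishing holomorphic $m$-form $\eta$, the squared phase of a Lagrangian subspace with basis $e_1,\dots,e_m$ is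 $\eta(e_1,\dots,e_m)^2/|\eta(e_1,\dots,e_m)|^2$, and a grading of a Lagrangian submanifold $\Lambda$ is a smooth function $\widetilde\alpha:\Lambda\to\mathbb R$ such that $e^{2\pi i\widetilde\alpha(q)}$ is the squared phase of $T_q\Lambda$ for every $q\in\Lambda$. If two graded Lagrangians $\widetilde\Lambda_0,\widetilde\Lambda_1$ meet transversally at $q$, choose a linear symplectomorphism $A$ from the tangent space at $q$ onto $\mathbb C^m$ with $A(T_q\Lambda_0)=\mathbb R^m$, $A(T_q\Lambda_1)=i\mathbb R^m$, and a continuous lift $\theta:[0,1]\to\mathbb R$ with $\theta(0)=\widetilde\alpha_0(q)$ of the squared phase of the path $\lambda(t)=A^{-1}(e^{-i\pi t/2}\mathbb R^m)$; the degree is the integer $\deg(\widetilde\Lambda_0,\widetilde\Lambda_1;q)=(\widetilde\alpha_1(q)-\widetilde\alpha_0(q))-(\theta(1)-\theta(0))$, which does not depend on the choices. These notions are used in $(Y,\omega,\Omega)$, in $(Y_c,\omega_c,\Omega_c)$ for $c\in C$, and in $(\mathbb C,dx\wedge dy,dz)$. Theorem. Let $L_0,L_1$ be fibered Lagrangians and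 let $p\in L_0\cap L_1$, $c=v(p)$, be such that $L_{0,c}$ and $L_{1,c}$ meet transversally at $p$ in $Y_c$ and the base curves $v(L_0)$, $v(L_1)$ meet transversally at $c$. Assume that $L_{0,c}$ and $L_{1,c}$ admit gradings. Then $v(L_0)$ and $v(L_1)$ admit gradings, and for any choice of gradings $\widetilde L_{j,c}=(L_{j,c},\widetilde\alpha_{L_{j,c}})$ and $\widetilde{v(L_j)}=(v(L_j),\widetilde\alpha_{v(L_j)})$, $j=0,1$, there are gradings $\widetilde L_j=(L_j,\widetilde\alpha_{L_j})$ with $\widetilde\alpha_{L_j}(q)=\widetilde\alpha_{L_{j,c}}(q)+\widetilde\alpha_{v(L_j)}(c)$ for all $q\in L_{j,c}$, such that $$\deg(\widetilde L_0,\widetilde L_1;p)=\deg_{Y_c}(\widetilde L_{0,c},\widetilde L_{1,c};p)+\deg_{\mathbb C}(\widetilde{v(L_0)},\widetilde{v(L_1)};c).$$ -/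

import Mathlib

open scoped Manifold ContDiff Topology

noncomputable section

/-! ### Linear algebra: squared phases, Lagrangian subspaces, the degree of a transverse pair -/

section LinearAlgebra

variable {V : Type*} [AddCommGroup V] [Module ℂ V]

/-- `Λ` is a Lagrangian subspace for the bilinear form `σ`: it is its own `σ`-orthogonal. -/
def IsLagrangianSubspace (σ : V → V → ℝ) (Λ : Submodule ℝ V) : Prop :=
  ∀ u : V, u ∈ Λ ↔ ∀ w ∈ Λ, σ u w = 0

/-- `z` is the squared phase `η(e₁, …, e_m)² / |η(e₁, …, e_m)|²` of the `m`-dimensional real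
subspace `Λ`, computed in an ordered real basis of `Λ`. The value does not depend on the basis. -/
def IsSquaredPhase {m : ℕ} (η : V [⋀^Fin m]→ₗ[ℂ] ℂ) (Λ : Submodule ℝ V) (z : ℂ) : Prop :=
  ∃ e : Module.Basis (Fin m) ℝ Λ,
    z = η (fun i => (e i : V)) ^ 2 / ((‖η (fun i => (e i : V))‖ ^ 2 : ℝ) : ℂ)

/-- The standard symplectic form `∑ dx_k ∧ dy_k` on `ℂ^m`. -/
def stdSymplectic (m : ℕ) (z w : Fin m → ℂ) : ℝ :=
  ∑ k, ((z k).re * (w k).im - (z k).im * (w k).re)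

/-- The real subspace `c ℝ^m` of `ℂ^m`. -/
def rotatedReal (m : ℕ) (c : ℂ) : Submodule ℝ (Fin m → ℂ) where
  carrier := {z | ∃ x : Fin m → ℝ, ∀ k, z k = c * (x k : ℂ)}
  zero_mem' := ⟨0, fun k => by simp⟩
  add_mem' := by
    rintro z w ⟨x, hx⟩ ⟨y, hy⟩
    exact ⟨x + y, fun k => by simp [hx k, hy k, mul_add]⟩
  smul_mem' := by
    rintro r z ⟨x, hx⟩
    exact ⟨r • x, fun k => by simp [hx k, mul_left_comm]⟩

/-- `A` is a linear symplectomorphism onto `ℂ^m` with `A Λ₀ = ℝ^m` and `A Λ₁ = i ℝ^m`. -/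
structure IsAdaptedFrame {m : ℕ} (σ : V → V → ℝ) (Λ₀ Λ₁ : Submodule ℝ V)
    (A : V ≃ₗ[ℝ] (Fin m → ℂ)) : Prop where
  symplectic : ∀ u w : V, stdSymplectic m (A u) (A w) = σ u w
  map_zero_side : Λ₀.map A.toLinearMap = rotatedReal m 1
  map_one_side : Λ₁.map A.toLinearMap = rotatedReal m Complex.I

/-- The canonical short path `λ(t) = A⁻¹ (e^{-iπt/2} ℝ^m)`, from `Λ₀` to `Λ₁`. -/
def canonicalShortPath {m : ℕ} (A : V ≃ₗ[ℝ] (Fin m → ℂ)) (t : ℝ) : Submodule ℝ V :=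
  (rotatedReal m (Complex.exp (-(Complex.I * Real.pi * t / 2)))).comap A.toLinearMap

/-- `θ` is a continuous lift to `ℝ` of the squared phase of the canonical short path of `A`,
starting at `φ₀`. -/
structure IsPhaseLift {m : ℕ} (η : V [⋀^Fin m]→ₗ[ℂ] ℂ) (A : V ≃ₗ[ℝ] (Fin m → ℂ)) (φ₀ : ℝ)
    (θ : ℝ → ℝ) : Prop where
  continuousOn : ContinuousOn θ (Set.Icc 0 1)
  lift : ∀ t ∈ Set.Icc (0 : ℝ) 1,
    IsSquaredPhase η (canonicalShortPath A t) (Complex.exp (2 * Real.pi * Complex.I * θ t))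
  start : θ 0 = φ₀

/-- `d` is the Floer degree `(φ₁ - φ₀) - (θ(1) - θ(0))` of the pair of transverse Lagrangian
subspaces `Λ₀, Λ₁` of `(V, σ)` with phase lifts `φ₀, φ₁`: canonical short paths and phase lifts
along them exist, and all of them give the value `d`. -/
structure IsFloerDegree {m : ℕ} (σ : V → V → ℝ) (η : V [⋀^Fin m]→ₗ[ℂ] ℂ)
    (Λ₀ Λ₁ : Submodule ℝ V) (φ₀ φ₁ : ℝ) (d : ℤ) : Prop where
  exists_lift : ∃ (A : V ≃ₗ[ℝ] (Fin m → ℂ)) (θ : ℝ → ℝ),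
    IsAdaptedFrame σ Λ₀ Λ₁ A ∧ IsPhaseLift η A φ₀ θ
  eq : ∀ (A : V ≃ₗ[ℝ] (Fin m → ℂ)) (θ : ℝ → ℝ),
    IsAdaptedFrame σ Λ₀ Λ₁ A → IsPhaseLift η A φ₀ θ → (d : ℝ) = (φ₁ - φ₀) - (θ 1 - θ 0)

/-- The area form `dx ∧ dy` on `ℂ`. -/
def areaForm (z w : ℂ) : ℝ := z.re * w.im - z.im * w.re

/-- The holomorphic volume form `dz` on `ℂ`, as an alternating `1`-form. -/
def dzForm : ℂ [⋀^Fin 1]→ₗ[ℂ] ℂ := AlternatingMap.ofSubsingleton ℂ ℂ ℂ (0 : Fin 1) LinearMap.id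

end LinearAlgebra

/-! ### Differential forms on manifolds, tangent spaces of parametrized submanifolds -/

section Manifolds

variable {E Y : Type*} [NormedAddCommGroup E] [TopologicalSpace Y] [ChartedSpace E Y]

/-- The expression, in the preferred chart at `x`, of a differential form `η`: the pullback of
`η` under the inverse of the chart. Here `E` is identified with the tangent space at each point
of `Y`, as it is in the definition of `TangentSpace`. -/
def chartForm (𝕜 : Type*) [NontriviallyNormedField 𝕜] [NormedSpace 𝕜 E]
    {G : Type*} [NormedAddCommGroup G] [NormedSpace 𝕜 G] {k : ℕ}
    (η : Y → E [⋀^Fin k]→L[𝕜] G) (x : Y) (z : E) : E [⋀^Fin k]→L[𝕜] G :=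
  (η ((extChartAt 𝓘(𝕜, E) x).symm z)).compContinuousLinearMap
    (mfderiv 𝓘(𝕜, E) 𝓘(𝕜, E) (extChartAt 𝓘(𝕜, E) x).symm z)

/-- The image of the tangent space at `x` under the derivative of `f`; when `f` is an embedding
with image `S`, this is the tangent space of `S` at `f x`, as a subspace of `T_{f x} Y = E`. -/
def tangentImage [NormedSpace ℝ E] {B H M : Type*} [NormedAddCommGroup B] [NormedSpace ℝ B]
    [TopologicalSpace H] (I : ModelWithCorners ℝ B H) [TopologicalSpace M] [ChartedSpace H M]
    (f : M → Y) (x : M) : Submodule ℝ E :=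
  let D : B →L[ℝ] E := mfderiv I 𝓘(ℝ, E) f x
  LinearMap.range (D : B →ₗ[ℝ] E)

end Manifolds

/-! ### Kähler Landau-Ginzburg models with a holomorphic volume form -/

/-- A Kähler manifold `Y` of complex dimension `n + 1` (a complex manifold modelled on `E`, with
complex structure given by multiplication by `i` on tangent spaces), a holomorphic function
`v : Y → ℂ` with finitely many critical values, and a nowhere vanishing holomorphic
`(n + 1)`-form on `Y`. -/
structure KahlerLGModel (n : ℕ) (E Y : Type*) [NormedAddCommGroup E] [NormedSpace ℂ E]
    [TopologicalSpace Y] [ChartedSpace E Y] where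
  /-- the complex dimension of `Y` is `n + 1` -/
  dim_eq : Module.finrank ℂ E = n + 1
  /-- the Kähler form -/
  kform : Y → E [⋀^Fin 2]→L[ℝ] ℝ
  kform_smooth : ∀ x : Y, ContDiffOn ℝ ∞ (chartForm ℝ kform x) (extChartAt 𝓘(ℝ, E) x).target
  kform_closed : ∀ x : Y, ∀ z ∈ (extChartAt 𝓘(ℝ, E) x).target,
    extDeriv (chartForm ℝ kform x) z = 0
  kform_invariant : ∀ (y : Y) (u w : E),
    kform y ![Complex.I • u, Complex.I • w] = kform y ![u, w]
  kform_pos : ∀ (y : Y) (u : E), u ≠ 0 → 0 < kform y ![u, Complex.I • u]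
  /-- the superpotential -/
  v : Y → ℂ
  v_holomorphic : ContMDiff 𝓘(ℂ, E) 𝓘(ℂ, ℂ) ω v
  finite_critical_values : (v '' {y | mfderiv 𝓘(ℂ, E) 𝓘(ℂ, ℂ) v y = 0}).Finite
  /-- the holomorphic volume form -/
  vol : Y → E [⋀^Fin (n + 1)]→L[ℂ] ℂ
  vol_holomorphic : ∀ x : Y, ContDiffOn ℂ ω (chartForm ℂ vol x) (extChartAt 𝓘(ℂ, E) x).target
  vol_ne_zero : ∀ y : Y, vol y ≠ 0

namespace KahlerLGModel

variable {n : ℕ} {E Y : Type*} [NormedAddCommGroup E] [NormedSpace ℂ E]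
  [TopologicalSpace Y] [ChartedSpace E Y] (X : KahlerLGModel n E Y)

/-- The Kähler form at `p` as a bilinear function. -/
def symp (p : Y) (u w : E) : ℝ := X.kform p ![u, w]

/-- The holomorphic volume form at `p`, as an algebraic alternating form. -/
def volAt (p : Y) : E [⋀^Fin (n + 1)]→ₗ[ℂ] ℂ := (X.vol p).toAlternatingMap

/-- The differential `dv_p`. -/
def dv (p : Y) : E →L[ℂ] ℂ := mfderiv 𝓘(ℂ, E) 𝓘(ℂ, ℂ) X.v p

/-- The set `C` of regular values of `v`. -/
def regularValues : Set ℂ := (X.v '' {y | X.dv y = 0})ᶜ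

/-- The vertical space `ker dv_p`, the tangent space of the fibre through `p`. -/
def Vert (p : Y) : Submodule ℂ E := LinearMap.ker (X.dv p : E →ₗ[ℂ] ℂ)

/-- `u` lies in the horizontal space at `p`, the `ω`-orthogonal of the vertical space. -/
def IsHorizontal (p : Y) (u : E) : Prop := ∀ w ∈ X.Vert p, X.symp p u w = 0

/-- The form `ω_c` of the fibre through `p`, at `p`. -/
def fiberSymp (p : Y) (u w : X.Vert p) : ℝ := X.symp p u w

/-- A real subspace of `T_p Y`, intersected with the vertical space and seen as a subspace of it. -/
def vertPart (p : Y) (Λ : Submodule ℝ E) : Submodule ℝ (X.Vert p) :=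
  Λ.comap ((X.Vert p).subtype.restrictScalars ℝ)

open Classical in
/-- A tangent vector `w` at `p` with `dv_p w = 1` (at a regular point `p`). -/
def unitLift (p : Y) : E := if h : ∃ w : E, X.dv p w = 1 then h.choose else 0

/-- The Poincaré residue at `p`: the `n`-form `Ω_c (u₁, …, u_n) = Ω (u₁, …, u_n, w)` on the
vertical space, where `dv_p w = 1`. -/
def fiberVol (p : Y) : X.Vert p [⋀^Fin n]→ₗ[ℂ] ℂ :=
  (((X.volAt p).domDomCongr (finRotate (n + 1))).curryLeft (X.unitLift p)).compLinearMap
    (X.Vert p).subtype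

theorem fiberVol_apply (p : Y) (u : Fin n → X.Vert p) :
    X.fiberVol p u = X.volAt p (Fin.snoc (fun i => (u i : E)) (X.unitLift p)) := by
  have h : (fun i => (Matrix.vecCons (X.unitLift p) (fun i => (u i : E)) : Fin (n + 1) → E)
      (finRotate (n + 1) i)) = Fin.snoc (fun i => (u i : E)) (X.unitLift p) := by
    funext i
    refine Fin.lastCases ?_ (fun j => ?_) i
    · simp
    · simp
  rw [← h]
  rfl

/-- The defining property of the residue, `Ω = Ω_c ∧ dv` on `ker dv × T_p Y`; in particular it
does not depend on the choice of the lift. -/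
theorem fiberVol_mul_dv (p : Y) (hp : X.dv p ≠ 0) (u : Fin n → X.Vert p) (w : E) :
    X.fiberVol p u * X.dv p w = X.volAt p (Fin.snoc (fun i => (u i : E)) w) := by
  have hex : ∃ w : E, X.dv p w = 1 := by
    obtain ⟨a, ha⟩ : ∃ a, X.dv p a ≠ 0 := by
      by_contra hcon
      push Not at hcon
      exact hp (ContinuousLinearMap.ext hcon)
    exact ⟨(X.dv p a)⁻¹ • a, by simp [ha]⟩
  have hlift : X.dv p (X.unitLift p) = 1 := by
    rw [unitLift, dif_pos hex]
    exact hex.choose_spec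
  have hfin : FiniteDimensional ℂ E := FiniteDimensional.of_finrank_pos (by rw [X.dim_eq]; omega)
  have hrank : Module.finrank ℂ (X.Vert p) = n := by
    have h1 := LinearMap.finrank_range_add_finrank_ker (X.dv p : E →ₗ[ℂ] ℂ)
    have h2 : LinearMap.range (X.dv p : E →ₗ[ℂ] ℂ) = ⊤ := by
      rw [LinearMap.range_eq_top]
      intro c
      exact ⟨c • X.unitLift p, by simp [hlift]⟩
    rw [h2, finrank_top, X.dim_eq, Module.finrank_self] at h1
    change Module.finrank ℂ (LinearMap.ker (X.dv p : E →ₗ[ℂ] ℂ)) = n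
    omega
  have hsn : ∀ y : E, (Fin.snoc (fun i => (u i : E)) y : Fin (n + 1) → E)
      = Function.update (Fin.snoc (fun i => (u i : E)) 0 : Fin (n + 1) → E) (Fin.last n) y := by
    intro y
    rw [Fin.update_snoc_last]
  -- vertical last entries give zero
  have hzero : ∀ y : E, X.dv p y = 0 → X.volAt p (Fin.snoc (fun i => (u i : E)) y) = 0 := by
    intro y hy
    have hmem : y ∈ X.Vert p := hy
    let s : Fin (n + 1) → X.Vert p := Fin.snoc u ⟨y, hmem⟩
    have hs : (Fin.snoc (fun i => (u i : E)) y : Fin (n + 1) → E)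
        = fun i => (X.Vert p).subtype (s i) := by
      funext i
      refine Fin.lastCases ?_ (fun j => ?_) i <;> simp [s]
    rw [hs]
    have hdep : ¬ LinearIndependent ℂ s := by
      intro hli
      have := hli.fintype_card_le_finrank
      rw [hrank, Fintype.card_fin] at this
      omega
    have := ((X.volAt p).compLinearMap (X.Vert p).subtype).map_linearDependent s hdep
    exact this
  have hdec : w = X.dv p w • X.unitLift p + (w - X.dv p w • X.unitLift p) := by abel
  have hker : X.dv p (w - X.dv p w • X.unitLift p) = 0 := by simp [hlift]
  rw [fiberVol_apply]
  conv_rhs => rw [hdec, hsn, AlternatingMap.map_update_add, AlternatingMap.map_update_smul,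
    ← hsn, ← hsn, hzero _ hker]
  rw [add_zero, smul_eq_mul, mul_comm]

end KahlerLGModel

/-! ### Fibered Lagrangians and their gradings -/

/-- A fibered Lagrangian: a smooth embedded curve `γ` in the set of regular values of `v`, a
Lagrangian `ℓ` in the fibre over `γ 0`, and the submanifold `L` of `Y` swept out by `ℓ` under
symplectic parallel transport along `γ`. The manifold `L` is embedded by `map : ℓ × ℝ → Y`, where
`map (q, ·)` is the horizontal lift of `γ` through the point `map (q, 0)` of the initial
Lagrangian; only this initial Lagrangian is required to be Lagrangian. -/
structure FiberedLagrangian {n : ℕ} {E Y : Type*} [NormedAddCommGroup E] [NormedSpace ℂ E]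
    [TopologicalSpace Y] [ChartedSpace E Y] (X : KahlerLGModel n E Y)
    (ℓ : Type*) [TopologicalSpace ℓ] [ChartedSpace (EuclideanSpace ℝ (Fin n)) ℓ] where
  /-- the base curve -/
  γ : ℝ → ℂ
  γ_smooth : ContDiff ℝ ∞ γ
  γ_immersion : ∀ t, deriv γ t ≠ 0
  γ_embedding : Topology.IsEmbedding γ
  γ_regular : ∀ t, γ t ∈ X.regularValues
  /-- the embedding of `L` into `Y` -/
  map : ℓ × ℝ → Y
  map_smooth : ContMDiff ((𝓡 n).prod 𝓘(ℝ, ℝ)) 𝓘(ℝ, E) ∞ map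
  map_immersion : ∀ x, Function.Injective (mfderiv ((𝓡 n).prod 𝓘(ℝ, ℝ)) 𝓘(ℝ, E) map x)
  map_embedding : Topology.IsEmbedding map
  map_over : ∀ q t, X.v (map (q, t)) = γ t
  horizontal : ∀ q t, X.IsHorizontal (map (q, t))
    (mfderiv 𝓘(ℝ, ℝ) 𝓘(ℝ, E) (fun s => map (q, s)) t (1 : ℝ))
  initial_lagrangian : ∀ q, IsLagrangianSubspace (X.fiberSymp (map (q, 0)))
    (X.vertPart (map (q, 0)) (tangentImage (𝓡 n) (fun q' => map (q', 0)) q))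

namespace FiberedLagrangian

variable {n : ℕ} {E Y : Type*} [NormedAddCommGroup E] [NormedSpace ℂ E]
  [TopologicalSpace Y] [ChartedSpace E Y] {X : KahlerLGModel n E Y}
  {ℓ : Type*} [TopologicalSpace ℓ] [ChartedSpace (EuclideanSpace ℝ (Fin n)) ℓ]
  (L : FiberedLagrangian X ℓ)

/-- The tangent space of `L` at `map (q, t)`. -/
def tangent (q : ℓ) (t : ℝ) : Submodule ℝ E :=
  tangentImage ((𝓡 n).prod 𝓘(ℝ, ℝ)) L.map (q, t)

/-- The tangent space, at `map (q, t)`, of `L_{γ t} = L ∩ v⁻¹(γ t)`, which is embedded by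
`map (·, t)`. -/
def fiberTangent (q : ℓ) (t : ℝ) : Submodule ℝ E :=
  tangentImage (𝓡 n) (fun q' => L.map (q', t)) q

/-- The tangent line, at `γ t`, of the base curve `v(L)`. -/
def baseTangent (t : ℝ) : Submodule ℝ ℂ := Submodule.span ℝ {deriv L.γ t}

/-- `α` is a grading of `L`: a smooth real lift of its squared phase function. -/
structure IsGrading (α : ℓ × ℝ → ℝ) : Prop where
  smooth : ContMDiff ((𝓡 n).prod 𝓘(ℝ, ℝ)) 𝓘(ℝ, ℝ) ∞ α
  lift : ∀ q t, IsSquaredPhase (X.volAt (L.map (q, t))) (L.tangent q t)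
    (Complex.exp (2 * Real.pi * Complex.I * α (q, t)))

/-- `a` is a grading of the Lagrangian `L_c` in the fibre over `c = γ t`, equipped with the
residue `Ω_c`. -/
structure IsFiberGrading (t : ℝ) (a : ℓ → ℝ) : Prop where
  smooth : ContMDiff (𝓡 n) 𝓘(ℝ, ℝ) ∞ a
  lift : ∀ q, IsSquaredPhase (X.fiberVol (L.map (q, t)))
    (X.vertPart (L.map (q, t)) (L.fiberTangent q t))
    (Complex.exp (2 * Real.pi * Complex.I * a q))

/-- `b` is a grading of the base curve `v(L)` in `ℂ`, parametrized by `γ`. -/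
structure IsBaseGrading (b : ℝ → ℝ) : Prop where
  smooth : ContDiff ℝ ∞ b
  lift : ∀ t, IsSquaredPhase dzForm (L.baseTangent t)
    (Complex.exp (2 * Real.pi * Complex.I * b t))

end FiberedLagrangian

end

/-!
The degree is a statement about the tangent spaces at `p`, and these split. The tangent space of a
fibered Lagrangian `L` at a point over `γ t` is spanned by the tangent space of the fibre `L_{γ t}`,
which is vertical, and by the horizontal lift of `γ'(t)`. The residue satisfies
`Ω(e₁, …, e_n, h) = Ω_c(e₁, …, e_n) dv(h)`, so the squared phase of `L` is the product of the squared
phases of the fibre and of the base curve (`FiberedLagrangian.volAt_frame`).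

The horizontal space is a complex line on which the Kähler form is a positive multiple of the
pullback of the area form under `dv` (`KahlerLGModel.IsHorizontal.symp_mul`), and it is orthogonal to
the vertical space. Hence adapted frames of the fibre and of the base combine, after a rescaling, to
an adapted frame of `T_p Y`, along whose canonical short path the phases add
(`KahlerLGModel.exists_isPhaseLift_add`). This gives the formula for the degrees, provided that they
do not depend on the adapted frames. They do not (`IsPhaseLift.end_eq`): the canonical short path is
spanned by `cos(πt/2) e_k - sin(πt/2) f_k` with `σ(e_j, f_k)` symmetric and positive definite; for a
given `e` and a given span of `f` these pairings form a convex set, so any two short paths are joined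
through short paths of Lagrangian, hence totally real, subspaces, on which `η` does not vanish.

Two facts of a global nature enter. The fibres `L_{γ t}` are Lagrangian for all `t`, and not only for
`t = 0`: the pullback of `ω` to `ℓ × ℝ` is closed, and its contraction with the `ℝ`-direction
vanishes by horizontality, so it is constant in that direction
(`FiberedLagrangian.symp_diff_diff_eq_zero`). Consequently the squared phase of `L` is a well defined
smooth function on `ℓ × ℝ`, and a lift over the slice at `t₀` extends by the homotopy lifting property
of the covering `ℝ → S¹` to a smooth lift (`FiberedLagrangian.exists_isGrading`).
-/

noncomputable section

/-! ### Squared phases of complex numbers and of real subspaces -/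

/-- The squared phase `z² / |z|²` of a complex number, with the junk value `0` at `z = 0`. -/
def squaredPhase (z : ℂ) : ℂ := z ^ 2 / ((‖z‖ ^ 2 : ℝ) : ℂ)

theorem squaredPhase_mul (z w : ℂ) :
    squaredPhase (z * w) = squaredPhase z * squaredPhase w := by
  simp only [squaredPhase, norm_mul, mul_pow, Complex.ofReal_mul]
  rw [mul_div_mul_comm]

theorem squaredPhase_ofReal {r : ℝ} (hr : r ≠ 0) : squaredPhase (r : ℂ) = 1 := by
  have : (r : ℂ) ≠ 0 := by exact_mod_cast hr
  rw [squaredPhase, Complex.norm_real, Real.norm_eq_abs, sq_abs, Complex.ofReal_pow, div_self]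
  positivity

theorem norm_squaredPhase {z : ℂ} (hz : z ≠ 0) : ‖squaredPhase z‖ = 1 := by
  rw [squaredPhase, norm_div, norm_pow, Complex.norm_real, norm_pow, norm_norm, div_self]
  exact pow_ne_zero _ (norm_ne_zero_iff.2 hz)

theorem squaredPhase_ne_zero_iff {z : ℂ} : squaredPhase z ≠ 0 ↔ z ≠ 0 := by
  constructor
  · rintro h rfl
    simp [squaredPhase] at h
  · intro hz h
    have := norm_squaredPhase hz
    simp [h] at this

theorem continuous_squaredPhase_comp {X : Type*} [TopologicalSpace X] {N : X → ℂ}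
    (hN : Continuous N) (h0 : ∀ x, N x ≠ 0) : Continuous fun x => squaredPhase (N x) := by
  unfold squaredPhase
  refine (hN.pow 2).div₀ (Complex.continuous_ofReal.comp (hN.norm.pow 2)) fun x => ?_
  exact_mod_cast pow_ne_zero _ (norm_ne_zero_iff.2 (h0 x))

/-- The squared phase as a point of the unit circle, at a nonzero complex number. -/
def circlePhase (z : ℂ) (hz : z ≠ 0) : Circle :=
  ⟨squaredPhase z, mem_sphere_zero_iff_norm.2 (norm_squaredPhase hz)⟩

theorem coe_circlePhase (z : ℂ) (hz : z ≠ 0) : (circlePhase z hz : ℂ) = squaredPhase z := rfl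

section LinearAlgebra

variable {V : Type*} [AddCommGroup V] [Module ℂ V] {m : ℕ}

/-- Two families with the same real span have values of `η` differing by a real determinant. -/
theorem map_basis_eq_det_mul (η : V [⋀^Fin m]→ₗ[ℂ] ℂ) {Λ : Submodule ℝ V}
    (b e : Module.Basis (Fin m) ℝ Λ) :
    η (fun i => (e i : V)) = (b.det e : ℂ) * η (fun i => (b i : V)) := by
  let f : Λ [⋀^Fin m]→ₗ[ℝ] ℂ := 
    { (η.toMultilinearMap.restrictScalars ℝ).compLinearMap fun _ => Λ.subtype with
      map_eq_zero_of_eq' := fun v i j h hij =>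
        η.map_eq_zero_of_eq (fun k => (v k : V)) (congrArg Subtype.val h) hij }
  have key : f = (LinearMap.toSpanSingleton ℝ ℂ (f b)).compAlternatingMap b.det := by
    refine Module.Basis.ext_alternating b fun i h => ?_
    let σ : Equiv.Perm (Fin m) := Equiv.ofBijective i (Finite.injective_iff_bijective.1 h)
    change f (b ∘ σ) = (LinearMap.toSpanSingleton ℝ ℂ (f b)) (b.det (b ∘ σ))
    rw [AlternatingMap.map_perm, AlternatingMap.map_perm, Module.Basis.det_self]
    rcases Int.units_eq_one_or (Equiv.Perm.sign σ) with h | h <;> simp [h]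
  have h := congrArg (fun g => g e) key
  change η (fun i => (e i : V)) = b.det e • η (fun i => (b i : V)) at h
  rw [h, Complex.real_smul]

theorem isSquaredPhase_span_iff (η : V [⋀^Fin m]→ₗ[ℂ] ℂ) {v : Fin m → V}
    (hv : LinearIndependent ℝ v) {z : ℂ} :
    IsSquaredPhase η (Submodule.span ℝ (Set.range v)) z ↔ z = squaredPhase (η v) := by
  let b : Module.Basis (Fin m) ℝ (Submodule.span ℝ (Set.range v)) := Module.Basis.span hv
  have hb : (fun i => (b i : V)) = v :=
    funext fun i => congrArg Subtype.val (Module.Basis.span_apply hv i)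
  constructor
  · rintro ⟨e, rfl⟩
    have h := map_basis_eq_det_mul η b e
    change squaredPhase _ = _
    rw [h, squaredPhase_mul, squaredPhase_ofReal (b.isUnit_det e).ne_zero, one_mul, hb]
  · rintro rfl
    exact ⟨b, by rw [hb]; rfl⟩

/-- Families with the same real span have the same squared phase. -/
theorem squaredPhase_eq_of_span_eq (η : V [⋀^Fin m]→ₗ[ℂ] ℂ) {v w : Fin m → V}
    (hv : LinearIndependent ℝ v) (hw : LinearIndependent ℝ w)
    (h : Submodule.span ℝ (Set.range v) = Submodule.span ℝ (Set.range w)) :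
    squaredPhase (η v) = squaredPhase (η w) := by
  rw [← isSquaredPhase_span_iff η hw, ← h]
  exact (isSquaredPhase_span_iff η hv).2 rfl

/-! ### Positive `(1, 1)`-forms and totally real families -/

/-- A Kähler form on a complex vector space: a real alternating bilinear form which is invariant
under multiplication by `i` and positive on complex lines. -/
structure IsKahlerForm (σ : LinearMap.BilinForm ℝ V) : Prop where
  self_eq_zero : ∀ u, σ u u = 0
  invariant : ∀ u w, σ (Complex.I • u) (Complex.I • w) = σ u w
  pos : ∀ u, u ≠ 0 → 0 < σ u (Complex.I • u)

namespace IsKahlerForm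

variable {σ : LinearMap.BilinForm ℝ V} (hσ : IsKahlerForm σ)
include hσ

theorem neg (u w : V) : σ u w = -σ w u := by
  have h := hσ.self_eq_zero (u + w)
  simp only [map_add, LinearMap.add_apply, hσ.self_eq_zero] at h
  linarith

theorem I_left (u w : V) : σ (Complex.I • u) w = -σ u (Complex.I • w) := by
  rw [← hσ.invariant u, smul_smul, Complex.I_mul_I, neg_one_smul, map_neg, neg_neg]

theorem eq_zero_of_I_smul {u : V} (h : σ u (Complex.I • u) = 0) : u = 0 := by
  by_contra hu
  exact (hσ.pos u hu).ne' h

/-- A linearly independent isotropic family is linearly independent over `ℂ`. -/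
theorem linearIndependent_complex {v : Fin m → V} (hv : LinearIndependent ℝ v)
    (hiso : ∀ j k, σ (v j) (v k) = 0) : LinearIndependent ℂ v := by
  rw [Fintype.linearIndependent_iff] at hv ⊢
  intro g hg
  set x := ∑ i, (g i).re • v i with hx
  set y := ∑ i, (g i).im • v i with hy
  have hxy : x + Complex.I • y = 0 := by
    rw [← hg, hx, hy, Finset.smul_sum, ← Finset.sum_add_distrib]
    refine Finset.sum_congr rfl fun i _ => ?_
    conv_rhs => rw [← Complex.re_add_im (g i), add_smul, mul_comm, mul_smul]
    rfl
  have hyx : σ y x = 0 := by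
    simp [hx, hy, map_sum, LinearMap.sum_apply, hiso]
  have hy0 : y = 0 := by
    refine hσ.eq_zero_of_I_smul ?_
    rw [eq_neg_of_add_eq_zero_right hxy, map_neg, hyx, neg_zero]
  have hx0 : x = 0 := by simpa [hy0] using hxy
  intro i
  exact Complex.ext (hv _ hx0 i) (hv _ hy0 i)

/-- A complex volume form does not vanish on a Lagrangian frame, because Lagrangian subspaces are
totally real. -/
theorem volume_ne_zero (hV : Module.finrank ℂ V = m) {η : V [⋀^Fin m]→ₗ[ℂ] ℂ} (hη : η ≠ 0)
    {v : Fin m → V} (hv : LinearIndependent ℝ v)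
    (hiso : ∀ j k, σ (v j) (v k) = 0) : η v ≠ 0 := by
  have hli := hσ.linearIndependent_complex hv hiso
  rcases Nat.eq_zero_or_pos m with rfl | hm
  · intro h
    refine hη (AlternatingMap.ext fun w => ?_)
    rw [Subsingleton.elim w v, h, AlternatingMap.zero_apply]
  · have : Nonempty (Fin m) := ⟨⟨0, hm⟩⟩
    have := (η.map_basis_ne_zero_iff
      (basisOfLinearIndependentOfCardEqFinrank hli (by simp [hV]))).2 hη
    rwa [coe_basisOfLinearIndependentOfCardEqFinrank] at this

end IsKahlerForm

end LinearAlgebra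

/-! ### Continuous lifts of squared phases -/

theorem circleExp_two_pi_mul_eq {x : ℝ} {z : ℂ} (hz : z ≠ 0)
    (h : Complex.exp (2 * Real.pi * Complex.I * x) = squaredPhase z) :
    Circle.exp (2 * Real.pi * x) = circlePhase z hz := by
  ext
  rw [Circle.coe_exp, coe_circlePhase, ← h]
  push_cast
  ring_nf

theorem exp_two_pi_mul_eq_of_circleExp {x : ℝ} {z : ℂ} {hz : z ≠ 0}
    (h : Circle.exp (2 * Real.pi * x) = circlePhase z hz) :
    Complex.exp (2 * Real.pi * Complex.I * x) = squaredPhase z := by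
  have h' := congrArg Subtype.val h
  rw [Circle.coe_exp] at h'
  rw [← coe_circlePhase z hz]
  refine Eq.trans ?_ h'
  push_cast
  ring_nf

theorem continuous_circlePhase_comp {X : Type*} [TopologicalSpace X] {N : X → ℂ}
    (hN : Continuous N) (h0 : ∀ x, N x ≠ 0) : Continuous fun x => circlePhase (N x) (h0 x) :=
  (continuous_squaredPhase_comp hN h0).subtype_mk _

/-- The squared phase of a path of nonzero complex numbers lifts continuously, from any initial
value. -/
theorem exists_phase_lift {N : ℝ → ℂ} (hN : Continuous N) (h0 : ∀ t, N t ≠ 0) {φ : ℝ}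
    (hφ : Complex.exp (2 * Real.pi * Complex.I * φ) = squaredPhase (N 0)) :
    ∃ θ : ℝ → ℝ, ContinuousOn θ (Set.Icc 0 1) ∧ θ 0 = φ ∧
      ∀ t ∈ Set.Icc (0 : ℝ) 1,
        Complex.exp (2 * Real.pi * Complex.I * θ t) = squaredPhase (N t) := by
  let c : C(unitInterval, Circle) :=
    ⟨fun t => circlePhase (N t) (h0 t),
      (continuous_circlePhase_comp hN h0).comp continuous_subtype_val⟩
  obtain ⟨Γ, hΓ, hΓ0⟩ := Circle.isCoveringMap_exp.exists_path_lifts c (2 * Real.pi * φ)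
    (circleExp_two_pi_mul_eq (h0 0) hφ).symm
  have hπ : (2 * Real.pi) ≠ 0 := by positivity
  refine ⟨fun t => Set.IccExtend zero_le_one Γ t / (2 * Real.pi), ?_, ?_, fun t ht => ?_⟩
  · exact (Γ.continuous.Icc_extend'.div_const _).continuousOn
  · change Set.IccExtend zero_le_one Γ 0 / (2 * Real.pi) = φ
    rw [Set.IccExtend_of_mem _ _ (⟨le_rfl, zero_le_one⟩ : (0 : ℝ) ∈ Set.Icc (0 : ℝ) 1)]
    change Γ 0 / _ = φ
    rw [hΓ0]
    field_simp
  · refine exp_two_pi_mul_eq_of_circleExp (hz := h0 t) ?_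
    change Circle.exp (2 * Real.pi * (Set.IccExtend zero_le_one Γ t / (2 * Real.pi))) = _
    rw [Set.IccExtend_of_mem _ _ ht, mul_div_cancel₀ _ hπ]
    exact congrFun hΓ ⟨t, ht⟩

/-- Phase lifts along the two ends of a homotopy of paths of nonzero complex numbers, with
constant squared phase at both ends of the paths, have the same total variation. -/
theorem phase_lift_eq_of_homotopy {N : ℝ × ℝ → ℂ} (hN : Continuous N)
    (h0 : ∀ u ∈ Set.Icc (0 : ℝ) 1, ∀ t, N (u, t) ≠ 0)
    (hstart : ∀ u ∈ Set.Icc (0 : ℝ) 1, squaredPhase (N (u, 0)) = squaredPhase (N (0, 0)))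
    (hend : ∀ u ∈ Set.Icc (0 : ℝ) 1, squaredPhase (N (u, 1)) = squaredPhase (N (0, 1)))
    {θ θ' : ℝ → ℝ} (hθ : ContinuousOn θ (Set.Icc 0 1)) (hθ' : ContinuousOn θ' (Set.Icc 0 1))
    (hθN : ∀ t ∈ Set.Icc (0 : ℝ) 1,
      Complex.exp (2 * Real.pi * Complex.I * θ t) = squaredPhase (N (0, t)))
    (hθN' : ∀ t ∈ Set.Icc (0 : ℝ) 1,
      Complex.exp (2 * Real.pi * Complex.I * θ' t) = squaredPhase (N (1, t)))
    (h : θ 0 = θ' 0) : θ 1 = θ' 1 := by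
  let M : unitInterval × unitInterval → ℂ := fun x => N (x.1, x.2)
  have hM : Continuous M := hN.comp (by fun_prop)
  have hM0 : ∀ x, M x ≠ 0 := fun x => h0 x.1 x.1.2 x.2
  let H : C(unitInterval × unitInterval, Circle) :=
    ⟨fun x => circlePhase (M x) (hM0 x), continuous_circlePhase_comp hM hM0⟩
  let c : unitInterval → C(unitInterval, Circle) := fun u =>
    ⟨fun t => H (u, t), H.continuous.comp (by fun_prop)⟩
  have hrel : (c 0).HomotopicRel (c 1) {0, 1} := by
    refine ⟨⟨⟨H, fun t => rfl, fun t => rfl⟩, fun u t ht => ?_⟩⟩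
    rcases ht with rfl | rfl
    · exact Subtype.ext (hstart u u.2)
    · exact Subtype.ext (hend u u.2)
  have hΓ : ∀ {ϑ : ℝ → ℝ}, ContinuousOn ϑ (Set.Icc 0 1) → ∀ u : unitInterval,
      (∀ t ∈ Set.Icc (0 : ℝ) 1,
        Complex.exp (2 * Real.pi * Complex.I * ϑ t) = squaredPhase (N (u, t))) →
      Continuous (fun t : unitInterval => 2 * Real.pi * ϑ t) ∧
        Circle.exp ∘ (fun t : unitInterval => 2 * Real.pi * ϑ t) = c u := by
    intro ϑ hϑ u hu
    refine ⟨continuous_const.mul (continuousOn_iff_continuous_domRestrict.1 hϑ), funext fun t => ?_⟩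
    exact circleExp_two_pi_mul_eq (hM0 (u, t)) (hu t t.2)
  obtain ⟨hc, hl⟩ := hΓ hθ 0 hθN
  obtain ⟨hc', hl'⟩ := hΓ hθ' 1 hθN'
  have e0 : c 0 0 = Circle.exp (2 * Real.pi * θ 0) := (congrFun hl 0).symm
  have e1 : c 1 0 = Circle.exp (2 * Real.pi * θ 0) := by
    rw [h]
    exact (congrFun hl' 0).symm
  have key := Circle.isCoveringMap_exp.liftPath_apply_one_eq_of_homotopicRel hrel
    (2 * Real.pi * θ 0) e0 e1
  rw [← (Circle.isCoveringMap_exp.eq_liftPath_iff e0).2 ⟨hc, hl, rfl⟩,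
    ← (Circle.isCoveringMap_exp.eq_liftPath_iff e1).2
      ⟨hc', hl', congrArg (2 * Real.pi * ·) h.symm⟩] at key
  exact mul_left_cancel₀ (by positivity) key

/-! ### Canonical short paths in terms of frames -/

section Frames

variable {V : Type*} [AddCommGroup V] [Module ℂ V] {m : ℕ}

/-- The rotating frame `cos(πt/2) e_k - sin(πt/2) f_k`, from `e` to `-f`. -/
def shortFrame (e f : Fin m → V) (t : ℝ) (k : Fin m) : V :=
  Real.cos (Real.pi * t / 2) • e k - Real.sin (Real.pi * t / 2) • f k

theorem shortFrame_zero (e f : Fin m → V) : shortFrame e f 0 = e := by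
  funext k
  simp [shortFrame]

theorem shortFrame_one (e f : Fin m → V) : shortFrame e f 1 = -f := by
  funext k
  simp [shortFrame]

theorem sum_smul_shortFrame (e f : Fin m → V) (t : ℝ) (x : Fin m → ℝ) :
    ∑ k, x k • shortFrame e f t k = Real.cos (Real.pi * t / 2) • ∑ k, x k • e k
      - Real.sin (Real.pi * t / 2) • ∑ k, x k • f k := by
  simp only [shortFrame, smul_sub, Finset.sum_sub_distrib, Finset.smul_sum]
  congr 1 <;> exact Finset.sum_congr rfl fun k _ => smul_comm _ _ _

theorem rotatedReal_eq_span (c : ℂ) :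
    rotatedReal m c = Submodule.span ℝ (Set.range fun k => (Pi.single k c : Fin m → ℂ)) := by
  ext z
  rw [Submodule.mem_span_range_iff_exists_fun]
  change (∃ x : Fin m → ℝ, ∀ k, z k = c * (x k : ℂ)) ↔ _
  refine exists_congr fun x => ?_
  rw [eq_comm, funext_iff]
  refine forall_congr' fun k => ?_
  simp [Finset.sum_apply, Pi.single_apply, mul_comm]

theorem comap_rotatedReal_eq_span (A : V ≃ₗ[ℝ] (Fin m → ℂ)) (c : ℂ) :
    (rotatedReal m c).comap A.toLinearMap
      = Submodule.span ℝ (Set.range fun k => A.symm (Pi.single k c)) := by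
  rw [rotatedReal_eq_span]
  have h := Submodule.map_equiv_eq_comap_symm A.symm
    (Submodule.span ℝ (Set.range fun k => (Pi.single k c : Fin m → ℂ)))
  rw [LinearEquiv.symm_symm] at h
  rw [← h, Submodule.map_span, ← Set.range_comp]
  rfl

theorem canonicalShortPath_eq_span (A : V ≃ₗ[ℝ] (Fin m → ℂ)) (t : ℝ) :
    canonicalShortPath A t = Submodule.span ℝ (Set.range
      (shortFrame (fun k => A.symm (Pi.single k 1)) (fun k => A.symm (Pi.single k Complex.I)) t)) := by
  rw [canonicalShortPath, comap_rotatedReal_eq_span]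
  congr 2
  funext k
  rw [shortFrame, ← map_smul, ← map_smul, ← map_sub]
  congr 1
  rw [← Pi.single_smul, ← Pi.single_smul, ← Pi.single_sub]
  congr 1
  rw [show -(Complex.I * Real.pi * t / 2) = ((-(Real.pi * t / 2) : ℝ) : ℂ) * Complex.I by
    push_cast; ring, Complex.exp_mul_I, ← Complex.ofReal_cos, ← Complex.ofReal_sin]
  simp [sub_eq_add_neg]

/-- Two families `e`, `f` spanning isotropic subspaces, with pairing `σ(e_j, f_k)` symmetric and
positive definite. The rotating frames from `e` to `-f` are then Lagrangian. -/
structure IsPositivePair (σ : LinearMap.BilinForm ℝ V) (e f : Fin m → V) : Prop where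
  left : ∀ j k, σ (e j) (e k) = 0
  right : ∀ j k, σ (f j) (f k) = 0
  symm : ∀ j k, σ (e j) (f k) = σ (e k) (f j)
  pos : ∀ x : Fin m → ℝ, x ≠ 0 → 0 < σ (∑ k, x k • e k) (∑ k, x k • f k)

/-- Two families `e`, `f` forming together a symplectic basis. -/
structure IsDarbouxPair (σ : LinearMap.BilinForm ℝ V) (e f : Fin m → V) : Prop where
  left : ∀ j k, σ (e j) (e k) = 0
  right : ∀ j k, σ (f j) (f k) = 0
  pairing : ∀ j k, σ (e j) (f k) = if j = k then 1 else 0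

theorem IsDarbouxPair.apply_sum {σ : LinearMap.BilinForm ℝ V} {e f : Fin m → V}
    (h : IsDarbouxPair σ e f) (x y : Fin m → ℝ) :
    σ (∑ k, x k • e k) (∑ k, y k • f k) = ∑ k, x k * y k := by
  simp [map_sum, LinearMap.sum_apply, h.pairing, mul_comm]

theorem IsDarbouxPair.isPositivePair {σ : LinearMap.BilinForm ℝ V} {e f : Fin m → V}
    (h : IsDarbouxPair σ e f) : IsPositivePair σ e f where
  left := h.left
  right := h.right
  symm j k := by rw [h.pairing, h.pairing]; simp only [eq_comm]
  pos x hx := by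
    rw [h.apply_sum]
    obtain ⟨k, hk⟩ := Function.ne_iff.1 hx
    exact Finset.sum_pos' (fun i _ => mul_self_nonneg _)
      ⟨k, Finset.mem_univ k, mul_self_pos.2 hk⟩

namespace IsPositivePair

variable {σ : LinearMap.BilinForm ℝ V} {e f g : Fin m → V}

theorem isotropic (hσ : IsKahlerForm σ) (h : IsPositivePair σ e f) (t : ℝ) (j k : Fin m) :
    σ (shortFrame e f t j) (shortFrame e f t k) = 0 := by
  simp only [shortFrame, map_sub, map_smul, LinearMap.sub_apply, LinearMap.smul_apply, h.left,
    h.right, hσ.neg (f j) (e k), h.symm k j, smul_eq_mul]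
  ring

theorem linearIndependent (h : IsPositivePair σ e f) (t : ℝ) :
    LinearIndependent ℝ (shortFrame e f t) := by
  rw [Fintype.linearIndependent_iff]
  intro x hx
  rw [sum_smul_shortFrame] at hx
  by_contra hne
  have hpos := h.pos x (by rintro rfl; simp at hne)
  set X := ∑ k, x k • e k with hX
  set F := ∑ k, x k • f k with hF
  have hXX : σ X X = 0 := by simp [hX, map_sum, LinearMap.sum_apply, h.left]
  have hFF : σ F F = 0 := by simp [hF, map_sum, LinearMap.sum_apply, h.right]
  have h1 := congrArg (σ X) hx
  have h2 := congrArg (fun u => σ u F) hx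
  simp only [map_sub, map_smul, hXX, map_zero, smul_eq_mul, LinearMap.sub_apply,
    LinearMap.smul_apply, hFF, LinearMap.zero_apply, mul_zero, zero_sub, sub_zero] at h1 h2
  have hc : Real.cos (Real.pi * t / 2) = 0 := by
    rcases mul_eq_zero.1 h2 with h | h
    · exact h
    · exact absurd h hpos.ne'
  have hs : Real.sin (Real.pi * t / 2) = 0 := by
    rcases mul_eq_zero.1 (neg_eq_zero.1 h1) with h | h
    · exact h
    · exact absurd h hpos.ne'
  have := Real.sin_sq_add_cos_sq (Real.pi * t / 2)
  rw [hc, hs] at this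
  norm_num at this

theorem volume_ne_zero (hσ : IsKahlerForm σ) (hV : Module.finrank ℂ V = m)
    {η : V [⋀^Fin m]→ₗ[ℂ] ℂ} (hη : η ≠ 0) (h : IsPositivePair σ e f) (t : ℝ) :
    η (shortFrame e f t) ≠ 0 :=
  hσ.volume_ne_zero hV hη (h.linearIndependent t) (h.isotropic hσ t)

theorem linearIndependent_left (h : IsPositivePair σ e f) : LinearIndependent ℝ e := by
  simpa [shortFrame_zero] using h.linearIndependent 0

theorem linearIndependent_right (h : IsPositivePair σ e f) : LinearIndependent ℝ f := by
  have := h.linearIndependent 1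
  rw [shortFrame_one] at this
  simpa using this.neg

/-- For fixed `e`, the families `f` in a given isotropic subspace forming a positive pair with `e`
form a convex set. -/
theorem convex_combination (h : IsPositivePair σ e f) (h' : IsPositivePair σ e g)
    (hfg : ∀ j k, σ (f j) (g k) = 0) (hgf : ∀ j k, σ (g j) (f k) = 0)
    {u : ℝ} (hu : u ∈ Set.Icc (0 : ℝ) 1) :
    IsPositivePair σ e (fun k => (1 - u) • f k + u • g k) where
  left := h.left
  right j k := by simp [h.right, h'.right, hfg, hgf]
  symm j k := by simp [h.symm j k, h'.symm j k]
  pos x hx := by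
    have : ∑ k, x k • ((1 - u) • f k + u • g k)
        = (1 - u) • ∑ k, x k • f k + u • ∑ k, x k • g k := by
      simp only [smul_add, Finset.sum_add_distrib, Finset.smul_sum]
      congr 1 <;> exact Finset.sum_congr rfl fun k _ => smul_comm _ _ _
    rw [this, map_add, map_smul, map_smul, smul_eq_mul, smul_eq_mul]
    have p := h.pos x hx
    have p' := h'.pos x hx
    rcases eq_or_lt_of_le hu.1 with rfl | hu0
    · simpa using p
    · have := mul_nonneg (sub_nonneg.2 hu.2) p.le
      have := mul_pos hu0 p'
      linarith

end IsPositivePair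

/-- A complex multilinear volume is continuous in the complex coordinates of its arguments. -/
theorem continuous_volume_of_coords {X : Type*} [TopologicalSpace X]
    (b : Module.Basis (Fin m) ℂ V) (η : V [⋀^Fin m]→ₗ[ℂ] ℂ) {w : X → Fin m → V}
    (hw : ∀ k i, Continuous fun x => b.repr (w x k) i) : Continuous fun x => η (w x) := by
  have : ∀ x, η (w x) = η b * (b.toMatrix (w x)).det := fun x => by
    conv_lhs => rw [η.eq_smul_basis_det b]
    rfl
  simp only [this]
  refine continuous_const.mul (Continuous.matrix_det ?_)
  exact continuous_matrix fun i k => hw k i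

theorem repr_real_smul (b : Module.Basis (Fin m) ℂ V) (r : ℝ) (u : V) (i : Fin m) :
    b.repr (r • u) i = r * b.repr u i := by
  rw [← Complex.coe_smul r u, map_smul, Finsupp.smul_apply, smul_eq_mul]

/-- The variation of the squared phase from `e` to `-f` depends on `f` only through its span. -/
theorem phase_lift_shortFrame_eq {σ : LinearMap.BilinForm ℝ V} (hσ : IsKahlerForm σ)
    (hV : Module.finrank ℂ V = m) {η : V [⋀^Fin m]→ₗ[ℂ] ℂ} (hη : η ≠ 0) {e f g : Fin m → V}
    (hf : IsPositivePair σ e f) (hg : IsPositivePair σ e g)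
    (hspan : Submodule.span ℝ (Set.range g) = Submodule.span ℝ (Set.range f))
    {θ θ' : ℝ → ℝ} (hθ : ContinuousOn θ (Set.Icc 0 1)) (hθ' : ContinuousOn θ' (Set.Icc 0 1))
    (hθf : ∀ t ∈ Set.Icc (0 : ℝ) 1,
      Complex.exp (2 * Real.pi * Complex.I * θ t) = squaredPhase (η (shortFrame e f t)))
    (hθg : ∀ t ∈ Set.Icc (0 : ℝ) 1,
      Complex.exp (2 * Real.pi * Complex.I * θ' t) = squaredPhase (η (shortFrame e g t)))
    (h : θ 0 = θ' 0) : θ 1 = θ' 1 := by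
  have hmem : ∀ k, g k ∈ Submodule.span ℝ (Set.range f) := fun k =>
    hspan ▸ Submodule.subset_span ⟨k, rfl⟩
  have hfg : ∀ j k, σ (f j) (g k) = 0 := by
    intro j k
    obtain ⟨c, hc⟩ := (Submodule.mem_span_range_iff_exists_fun ℝ).1 (hmem k)
    simp [← hc, hf.right]
  have hgf : ∀ j k, σ (g j) (f k) = 0 := fun j k => by rw [hσ.neg, hfg, neg_zero]
  let F : ℝ → Fin m → V := fun u k => (1 - u) • f k + u • g k
  have hF : ∀ u ∈ Set.Icc (0 : ℝ) 1, IsPositivePair σ e (F u) := fun u hu =>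
    hf.convex_combination hg hfg hgf hu
  have hF0 : F 0 = f := by funext k; simp [F]
  have hF1 : F 1 = g := by funext k; simp [F]
  let N : ℝ × ℝ → ℂ := fun x => η (shortFrame e (F x.1) x.2)
  have hli := hσ.linearIndependent_complex hf.linearIndependent_left hf.left
  have hN : Continuous N := by
    rcases Nat.eq_zero_or_pos m with rfl | hm
    · exact continuous_const.congr fun x => congrArg η (Subsingleton.elim e _)
    have : Nonempty (Fin m) := ⟨⟨0, hm⟩⟩
    refine continuous_volume_of_coords
      (basisOfLinearIndependentOfCardEqFinrank hli (by simp [hV])) η fun k i => ?_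
    simp only [shortFrame, F, map_sub, map_add, Finsupp.sub_apply, Finsupp.add_apply,
      repr_real_smul]
    fun_prop
  refine phase_lift_eq_of_homotopy hN (fun u hu t => (hF u hu).volume_ne_zero hσ hV hη t)
    (fun u hu => ?_) (fun u hu => ?_) hθ hθ' ?_ ?_ h
  · simp [N, shortFrame_zero]
  · refine squaredPhase_eq_of_span_eq η ((hF u hu).linearIndependent 1)
      ((hF 0 (by simp)).linearIndependent 1) ?_
    have hle : ∀ u ∈ Set.Icc (0 : ℝ) 1,
        Submodule.span ℝ (Set.range (shortFrame e (F u) 1)) = Submodule.span ℝ (Set.range f) := by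
      intro u hu
      have := FiniteDimensional.span_of_finite ℝ (Set.finite_range f)
      refine Submodule.eq_of_le_of_finrank_eq ?_ ?_
      · rw [Submodule.span_le]
        rintro _ ⟨k, rfl⟩
        rw [shortFrame_one]
        exact Submodule.neg_mem _ (Submodule.add_mem _
          (Submodule.smul_mem _ _ (Submodule.subset_span ⟨k, rfl⟩))
          (Submodule.smul_mem _ _ (hmem k)))
      · rw [finrank_span_eq_card ((hF u hu).linearIndependent 1),
          finrank_span_eq_card hf.linearIndependent_right]
    exact (hle u hu).trans (hle 0 (by simp)).symm
  · intro t ht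
    rw [hθf t ht]
    simp only [N, hF0]
  · intro t ht
    rw [hθg t ht]
    simp only [N, hF1]

/-! ### Adapted frames and symplectic bases -/

theorem IsAdaptedFrame.isDarbouxPair {σ : LinearMap.BilinForm ℝ V} {Λ₀ Λ₁ : Submodule ℝ V}
    {A : V ≃ₗ[ℝ] (Fin m → ℂ)} (h : IsAdaptedFrame (fun u w => σ u w) Λ₀ Λ₁ A) :
    IsDarbouxPair σ (fun k => A.symm (Pi.single k 1))
      (fun k => A.symm (Pi.single k Complex.I)) := by
  constructor <;> intro j k <;> rw [← h.symplectic] <;>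
    simp only [LinearEquiv.apply_symm_apply, stdSymplectic, Pi.single_apply]
  · exact Finset.sum_eq_zero fun i _ => by split_ifs <;> simp
  · exact Finset.sum_eq_zero fun i _ => by split_ifs <;> simp
  · rw [Finset.sum_eq_single j (fun i _ hi => by simp [hi]) (by simp)]
    rcases eq_or_ne j k with rfl | hjk <;> simp [*]

theorem eq_span_of_map_eq_rotatedReal {Λ : Submodule ℝ V} {A : V ≃ₗ[ℝ] (Fin m → ℂ)} {c : ℂ}
    (h : Λ.map A.toLinearMap = rotatedReal m c) :
    Λ = Submodule.span ℝ (Set.range fun k => A.symm (Pi.single k c)) := by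
  rw [← comap_rotatedReal_eq_span, ← h, Submodule.comap_map_eq_of_injective A.injective]

/-- A symplectic basis gives an adapted frame, by reading off the coordinates
`σ(u, f_k) + i σ(e_k, u)`. -/
theorem IsDarbouxPair.exists_isAdaptedFrame [FiniteDimensional ℂ V]
    {σ : LinearMap.BilinForm ℝ V} (hσ : IsKahlerForm σ) (hV : Module.finrank ℂ V = m)
    {e f : Fin m → V} (h : IsDarbouxPair σ e f) :
    ∃ A : V ≃ₗ[ℝ] (Fin m → ℂ),
      IsAdaptedFrame (fun u w => σ u w) (Submodule.span ℝ (Set.range e))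
        (Submodule.span ℝ (Set.range f)) A ∧
      (fun k => A.symm (Pi.single k 1)) = e ∧
      (fun k => A.symm (Pi.single k Complex.I)) = f := by
  let T : V →ₗ[ℝ] (Fin m → ℂ) := LinearMap.pi fun k =>
    Complex.ofRealCLM.toLinearMap ∘ₗ σ.flip (f k) +
      (Complex.I • Complex.ofRealCLM.toLinearMap) ∘ₗ σ (e k)
  have hT : ∀ u k, T u k = (σ u (f k) : ℂ) + Complex.I * (σ (e k) u : ℂ) := fun u k => rfl
  have hTe : ∀ j, T (e j) = Pi.single j 1 := by
    intro j
    funext k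
    rw [hT, h.pairing, h.left, Pi.single_apply]
    rcases eq_or_ne j k with rfl | hjk <;> simp [*, eq_comm]
  have hTf : ∀ j, T (f j) = Pi.single j Complex.I := by
    intro j
    funext k
    rw [hT, h.pairing, h.right, Pi.single_apply]
    split_ifs <;> simp_all
  have hsurj : Function.Surjective T := by
    intro z
    refine ⟨∑ k, ((z k).re • e k + (z k).im • f k), ?_⟩
    rw [map_sum]
    simp only [map_add, map_smul, hTe, hTf]
    funext k
    simp [Finset.sum_apply, Pi.single_apply, Finset.sum_add_distrib, Complex.re_add_im]
  have hrank : Module.finrank ℝ V = Module.finrank ℝ (Fin m → ℂ) := by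
    rw [finrank_real_of_complex V, finrank_real_of_complex (Fin m → ℂ), hV]
    simp
  have hinj : Function.Injective T :=
    (LinearMap.injective_iff_surjective_of_finrank_eq_finrank hrank).2 hsurj
  let A : V ≃ₗ[ℝ] (Fin m → ℂ) := LinearEquiv.ofBijective T ⟨hinj, hsurj⟩
  have hAT : ∀ u, A u = T u := fun u => rfl
  have hAe : ∀ j, A.symm (Pi.single j 1) = e j := fun j => by
    rw [LinearEquiv.symm_apply_eq, hAT, hTe]
  have hAf : ∀ j, A.symm (Pi.single j Complex.I) = f j := fun j => by
    rw [LinearEquiv.symm_apply_eq, hAT, hTf]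
  refine ⟨A, ⟨fun u w => ?_, ?_, ?_⟩, funext hAe, funext hAf⟩
  · have hdec : ∀ u : V, u = ∑ k, (A u k).re • e k + ∑ k, (A u k).im • f k := by
      intro u
      apply hinj
      rw [map_add, map_sum, map_sum]
      simp only [map_smul, hTe, hTf, hAT]
      funext k
      simp [Finset.sum_apply, Pi.single_apply, Complex.re_add_im]
    have hee : ∀ x y : Fin m → ℝ, σ (∑ k, x k • e k) (∑ k, y k • e k) = 0 := fun x y => by
      simp [map_sum, LinearMap.sum_apply, h.left]
    have hff : ∀ x y : Fin m → ℝ, σ (∑ k, x k • f k) (∑ k, y k • f k) = 0 := fun x y => by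
      simp [map_sum, LinearMap.sum_apply, h.right]
    have hfe : ∀ x y : Fin m → ℝ,
        σ (∑ k, x k • f k) (∑ k, y k • e k) = -∑ k, y k * x k := fun x y => by
      rw [hσ.neg, h.apply_sum]
    conv_rhs => rw [hdec u, hdec w]
    simp only [map_add, LinearMap.add_apply]
    rw [hee, hff, hfe, h.apply_sum, stdSymplectic, Finset.sum_sub_distrib]
    simp only [mul_comm]
    ring
  · rw [rotatedReal_eq_span, Submodule.map_span, ← Set.range_comp]
    congr 2
    exact funext hTe
  · rw [rotatedReal_eq_span, Submodule.map_span, ← Set.range_comp]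
    congr 2
    exact funext hTf

/-- A frame of a Lagrangian subspace extends to a symplectic basis by a frame of any given
transverse Lagrangian subspace. -/
theorem exists_isDarbouxPair [FiniteDimensional ℂ V] {σ : LinearMap.BilinForm ℝ V}
    (hσ : IsKahlerForm σ) (hV : Module.finrank ℂ V = m) {v w : Fin m → V}
    (hv : LinearIndependent ℝ v) (hw : LinearIndependent ℝ w)
    (hvv : ∀ j k, σ (v j) (v k) = 0) (hww : ∀ j k, σ (w j) (w k) = 0)
    (hvw : Submodule.span ℝ (Set.range v) ⊓ Submodule.span ℝ (Set.range w) = ⊥) :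
    ∃ f : Fin m → V, IsDarbouxPair σ v f ∧
      Submodule.span ℝ (Set.range f) = Submodule.span ℝ (Set.range w) := by
  set Λ₁ := Submodule.span ℝ (Set.range w) with hΛ₁
  have hr₁ : Module.finrank ℝ Λ₁ = m := by simpa using finrank_span_eq_card hw
  have hiso₁ : ∀ x ∈ Λ₁, ∀ y ∈ Λ₁, σ x y = 0 := by
    intro x hx y hy
    obtain ⟨a, rfl⟩ := (Submodule.mem_span_range_iff_exists_fun ℝ).1 hx
    obtain ⟨b, rfl⟩ := (Submodule.mem_span_range_iff_exists_fun ℝ).1 hy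
    simp [map_sum, LinearMap.sum_apply, hww]
  have hsup : Submodule.span ℝ (Set.range v) ⊔ Λ₁ = ⊤ := by
    refine Submodule.eq_top_of_disjoint _ _ ?_ (disjoint_iff.2 hvw)
    rw [hr₁, finrank_span_eq_card hv, finrank_real_of_complex, hV, Fintype.card_fin]
    omega
  let T : Λ₁ →ₗ[ℝ] (Fin m → ℝ) := LinearMap.pi fun k => σ (v k) ∘ₗ Λ₁.subtype
  have hT : ∀ (x : Λ₁) k, T x k = σ (v k) x := fun x k => rfl
  have hinj : Function.Injective T := by
    rw [injective_iff_map_eq_zero]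
    intro x hx
    have h0 : ∀ y : V, σ x y = 0 := by
      intro y
      obtain ⟨a, ha, b, hb, rfl⟩ := Submodule.mem_sup.1
        (show y ∈ Submodule.span ℝ (Set.range v) ⊔ Λ₁ from hsup ▸ Submodule.mem_top)
      obtain ⟨c, rfl⟩ := (Submodule.mem_span_range_iff_exists_fun ℝ).1 ha
      have : ∀ k, σ x (v k) = 0 := fun k => by
        rw [hσ.neg, ← hT, hx, Pi.zero_apply, neg_zero]
      simp [map_sum, this, hiso₁ x x.2 b hb]
    exact Subtype.ext (hσ.eq_zero_of_I_smul (h0 _))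
  have hsurj : Function.Surjective T :=
    (LinearMap.injective_iff_surjective_of_finrank_eq_finrank (by rw [hr₁]; simp)).1 hinj
  choose f hf using fun k => hsurj (Pi.single k 1)
  have hD : IsDarbouxPair σ v fun k => (f k : V) :=
    ⟨hvv, fun j k => hiso₁ _ (f j).2 _ (f k).2, fun j k => by
      rw [← hT, hf, Pi.single_apply]⟩
  refine ⟨_, hD, Submodule.eq_of_le_of_finrank_eq ?_ ?_⟩
  · rw [Submodule.span_le]
    rintro _ ⟨k, rfl⟩
    exact (f k).2
  · rw [hr₁, finrank_span_eq_card hD.isPositivePair.linearIndependent_right, Fintype.card_fin]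

/-! ### The degree of a transverse pair of Lagrangian subspaces -/

/-- A phase lift along the canonical short path of an adapted frame, in terms of the frame. -/
theorem isPhaseLift_iff {σ : LinearMap.BilinForm ℝ V} {η : V [⋀^Fin m]→ₗ[ℂ] ℂ}
    {Λ₀ Λ₁ : Submodule ℝ V} {A : V ≃ₗ[ℝ] (Fin m → ℂ)}
    (hA : IsAdaptedFrame (fun u w => σ u w) Λ₀ Λ₁ A) {φ : ℝ} {θ : ℝ → ℝ} :
    IsPhaseLift η A φ θ ↔ ContinuousOn θ (Set.Icc 0 1) ∧ θ 0 = φ ∧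
      ∀ t ∈ Set.Icc (0 : ℝ) 1, Complex.exp (2 * Real.pi * Complex.I * θ t) =
        squaredPhase (η (shortFrame (fun k => A.symm (Pi.single k 1))
          (fun k => A.symm (Pi.single k Complex.I)) t)) := by
  have key : ∀ t z, IsSquaredPhase η (canonicalShortPath A t) z ↔
      z = squaredPhase (η (shortFrame (fun k => A.symm (Pi.single k 1))
          (fun k => A.symm (Pi.single k Complex.I)) t)) := fun t z => by
    rw [canonicalShortPath_eq_span]
    exact isSquaredPhase_span_iff η (hA.isDarbouxPair.isPositivePair.linearIndependent t)
  simp only [← key]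
  exact ⟨fun h => ⟨h.1, h.3, h.2⟩, fun h => ⟨h.1, h.2.2, h.2.1⟩⟩

/-- The variation of the phase along canonical short paths does not depend on the adapted frame:
two adapted frames are joined by a path of positive pairs. -/
theorem IsPhaseLift.end_eq {σ : LinearMap.BilinForm ℝ V} (hσ : IsKahlerForm σ)
    (hV : Module.finrank ℂ V = m) {η : V [⋀^Fin m]→ₗ[ℂ] ℂ} (hη : η ≠ 0)
    {Λ₀ Λ₁ : Submodule ℝ V} {A A' : V ≃ₗ[ℝ] (Fin m → ℂ)}
    (hA : IsAdaptedFrame (fun u w => σ u w) Λ₀ Λ₁ A)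
    (hA' : IsAdaptedFrame (fun u w => σ u w) Λ₀ Λ₁ A') {φ : ℝ} {θ θ' : ℝ → ℝ}
    (hθ : IsPhaseLift η A φ θ) (hθ' : IsPhaseLift η A' φ θ') : θ 1 = θ' 1 := by
  obtain ⟨hc, h0, hl⟩ := (isPhaseLift_iff hA).1 hθ
  obtain ⟨hc', h0', hl'⟩ := (isPhaseLift_iff hA').1 hθ'
  have hD := hA.isDarbouxPair
  have hD' := hA'.isDarbouxPair
  have hs₀ := eq_span_of_map_eq_rotatedReal hA.map_zero_side
  have hs₀' := eq_span_of_map_eq_rotatedReal hA'.map_zero_side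
  have hs₁ := eq_span_of_map_eq_rotatedReal hA.map_one_side
  have hs₁' := eq_span_of_map_eq_rotatedReal hA'.map_one_side
  set e : Fin m → V := fun k => A.symm (Pi.single k 1)
  set f : Fin m → V := fun k => A.symm (Pi.single k Complex.I)
  set e' : Fin m → V := fun k => A'.symm (Pi.single k 1)
  set f' : Fin m → V := fun k => A'.symm (Pi.single k Complex.I)
  have hmem : ∀ k, e k ∈ Submodule.span ℝ (Set.range e') := fun k => by
    rw [← hs₀', hs₀]
    exact Submodule.subset_span ⟨k, rfl⟩
  choose P hP using fun k => (Submodule.mem_span_range_iff_exists_fun ℝ).1 (hmem k)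
  -- the frame `f'`, moved by the same matrix as `e'`, so that both rotating frames have one span
  let g : Fin m → V := fun k => ∑ b, P k b • f' b
  have hsum : ∀ (u : Fin m → V) (x : Fin m → ℝ),
      ∑ k, x k • ∑ b, P k b • u b = ∑ b, (∑ k, x k * P k b) • u b := by
    intro u x
    simp only [Finset.smul_sum, Finset.sum_smul, smul_smul]
    exact Finset.sum_comm
  have hli := hD.isPositivePair.linearIndependent_left
  have hg : IsPositivePair σ e g := by
    refine ⟨hD.left, fun j k => ?_, fun j k => ?_, fun x hx => ?_⟩
    · simp [g, map_sum, LinearMap.sum_apply, hD'.right]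
    · rw [← hP j, ← hP k, hD'.apply_sum, hD'.apply_sum]
      simp only [mul_comm]
    · have hxe : ∑ k, x k • e k = ∑ b, (∑ k, x k * P k b) • e' b := by
        rw [← hsum]
        simp only [hP]
      rw [hxe, hsum]
      refine hD'.isPositivePair.pos _ fun h => hx ?_
      rw [Fintype.linearIndependent_iff] at hli
      refine funext fun k => hli x ?_ k
      rw [hxe]
      exact Finset.sum_eq_zero fun b _ => by
        rw [show (∑ k, x k * P k b) = 0 from congrFun h b, zero_smul]
  have hspan : ∀ t, Submodule.span ℝ (Set.range (shortFrame e g t))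
      = Submodule.span ℝ (Set.range (shortFrame e' f' t)) := by
    intro t
    have := FiniteDimensional.span_of_finite ℝ (Set.finite_range (shortFrame e' f' t))
    refine Submodule.eq_of_le_of_finrank_eq ?_ ?_
    · rw [Submodule.span_le]
      rintro _ ⟨k, rfl⟩
      refine (Submodule.mem_span_range_iff_exists_fun ℝ).2 ⟨P k, ?_⟩
      rw [sum_smul_shortFrame, hP]
      rfl
    · rw [finrank_span_eq_card (hg.linearIndependent t),
        finrank_span_eq_card (hD'.isPositivePair.linearIndependent t)]
  refine phase_lift_shortFrame_eq hσ hV hη hD.isPositivePair hg ?_ hc hc' hl (fun t ht => ?_)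
    (h0.trans h0'.symm)
  · rw [← hs₁, hs₁']
    have := FiniteDimensional.span_of_finite ℝ (Set.finite_range f')
    refine Submodule.eq_of_le_of_finrank_eq ?_ ?_
    · rw [Submodule.span_le]
      rintro _ ⟨k, rfl⟩
      exact (Submodule.mem_span_range_iff_exists_fun ℝ).2 ⟨P k, rfl⟩
    · rw [finrank_span_eq_card hg.linearIndependent_right,
        finrank_span_eq_card hD'.isPositivePair.linearIndependent_right]
  · rw [hl' t ht]
    exact squaredPhase_eq_of_span_eq η (hD'.isPositivePair.linearIndependent t)
      (hg.linearIndependent t) (hspan t).symm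

theorem eq_add_intCast_of_exp_eq {x y : ℝ}
    (h : Complex.exp (2 * Real.pi * Complex.I * x) = Complex.exp (2 * Real.pi * Complex.I * y)) :
    ∃ d : ℤ, (d : ℝ) = x - y := by
  obtain ⟨d, hd⟩ := Complex.exp_eq_exp_iff_exists_int.1 h
  refine ⟨d, ?_⟩
  have h2 : (2 * Real.pi * Complex.I : ℂ) ≠ 0 := Complex.two_pi_I_ne_zero
  have : (x : ℂ) = y + d := by
    apply mul_left_cancel₀ h2
    rw [hd]
    ring
  have : x = y + d := by exact_mod_cast this
  linarith

/-- Transverse Lagrangian subspaces with phase lifts have a degree. -/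
theorem exists_isFloerDegree [FiniteDimensional ℂ V] {σ : LinearMap.BilinForm ℝ V}
    (hσ : IsKahlerForm σ) (hV : Module.finrank ℂ V = m) {η : V [⋀^Fin m]→ₗ[ℂ] ℂ} (hη : η ≠ 0)
    {v w : Fin m → V} (hv : LinearIndependent ℝ v) (hw : LinearIndependent ℝ w)
    (hvv : ∀ j k, σ (v j) (v k) = 0) (hww : ∀ j k, σ (w j) (w k) = 0)
    (hvw : Submodule.span ℝ (Set.range v) ⊓ Submodule.span ℝ (Set.range w) = ⊥)
    {φ₀ φ₁ : ℝ} (h₀ : Complex.exp (2 * Real.pi * Complex.I * φ₀) = squaredPhase (η v))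
    (h₁ : Complex.exp (2 * Real.pi * Complex.I * φ₁) = squaredPhase (η w)) :
    ∃ d : ℤ, IsFloerDegree (fun u w => σ u w) η (Submodule.span ℝ (Set.range v))
      (Submodule.span ℝ (Set.range w)) φ₀ φ₁ d := by
  obtain ⟨f, hD, hf⟩ := exists_isDarbouxPair hσ hV hv hw hvv hww hvw
  obtain ⟨A, hA, hAe, hAf⟩ := hD.exists_isAdaptedFrame hσ hV
  rw [hf] at hA
  have hN : Continuous fun t => η (shortFrame v f t) := by
    rcases Nat.eq_zero_or_pos m with rfl | hm
    · exact continuous_const.congr fun x => congrArg η (Subsingleton.elim v _)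
    have : Nonempty (Fin m) := ⟨⟨0, hm⟩⟩
    refine continuous_volume_of_coords (basisOfLinearIndependentOfCardEqFinrank
      (hσ.linearIndependent_complex hv hvv) (by simp [hV])) η fun k i => ?_
    simp only [shortFrame, map_sub, Finsupp.sub_apply, repr_real_smul]
    fun_prop
  obtain ⟨θ, hθ, hθ0, hθl⟩ := exists_phase_lift hN
    (fun t => hD.isPositivePair.volume_ne_zero hσ hV hη t) (φ := φ₀)
    (by rw [h₀, shortFrame_zero])
  have hP : IsPhaseLift η A φ₀ θ := (isPhaseLift_iff hA).2 ⟨hθ, hθ0, by rwa [hAe, hAf]⟩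
  have hend : Complex.exp (2 * Real.pi * Complex.I * θ 1) = squaredPhase (η w) := by
    rw [hθl 1 (by simp)]
    refine squaredPhase_eq_of_span_eq η (hD.isPositivePair.linearIndependent 1) hw ?_
    rw [← hf, shortFrame_one, ← Submodule.span_neg (Set.range f), ← Set.image_neg_eq_neg,
      ← Set.range_comp]
    rfl
  obtain ⟨d, hd⟩ := eq_add_intCast_of_exp_eq (h₁.trans hend.symm)
  refine ⟨d, ⟨A, θ, hA, hP⟩, fun A' θ' hA' hP' => ?_⟩
  rw [hd, ← hP.end_eq hσ hV hη hA hA' hP', hP'.start]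
  ring

end Frames

/-! ### The splitting of the tangent space into vertical and horizontal parts -/

theorem span_range_snoc {V : Type*} [AddCommGroup V] [Module ℝ V] {n : ℕ} (a : Fin n → V)
    (x : V) : Submodule.span ℝ (Set.range (Fin.snoc a x : Fin (n + 1) → V))
      = Submodule.span ℝ (Set.range a) ⊔ Submodule.span ℝ {x} := by
  rw [← Submodule.span_union]
  congr 1
  ext y
  simp [eq_comm]

/-- The area form `dx ∧ dy` of `ℂ`, as a bilinear form. -/
def areaBilin : LinearMap.BilinForm ℝ ℂ :=
  LinearMap.mk₂ ℝ areaForm (fun _ _ _ => by simp [areaForm]; ring)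
    (fun _ _ _ => by simp [areaForm]; ring) (fun _ _ _ => by simp [areaForm]; ring)
    (fun _ _ _ => by simp [areaForm]; ring)

theorem areaBilin_apply (z w : ℂ) : areaBilin z w = areaForm z w := rfl

theorem isKahlerForm_areaBilin : IsKahlerForm areaBilin where
  self_eq_zero u := by simp [areaBilin_apply, areaForm]; ring
  invariant u w := by simp [areaBilin_apply, areaForm]; ring
  pos u hu := by
    have : 0 < Complex.normSq u := Complex.normSq_pos.2 hu
    rw [Complex.normSq_apply] at this
    simpa [areaBilin_apply, areaForm] using this

theorem dzForm_apply (u : Fin 1 → ℂ) : dzForm u = u 0 := rfl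

theorem dzForm_ne_zero : dzForm ≠ 0 := fun h => by
  have := congrArg (fun g => g fun _ => (1 : ℂ)) h
  simp [dzForm_apply] at this

namespace KahlerLGModel

variable {n : ℕ} {E Y : Type*} [NormedAddCommGroup E] [NormedSpace ℂ E]
  [TopologicalSpace Y] [ChartedSpace E Y] (X : KahlerLGModel n E Y)

/-- The Kähler form at `p`, as a bilinear form. -/
def sympBilin (p : Y) : LinearMap.BilinForm ℝ E :=
  have h0 : ∀ u w x : E, Function.update ![u, w] 0 x = ![x, w] := fun u w x => by
    ext i
    fin_cases i <;> rfl
  have h1 : ∀ u w x : E, Function.update ![u, w] 1 x = ![u, x] := fun u w x => by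
    ext i
    fin_cases i <;> rfl
  LinearMap.mk₂ ℝ (X.symp p)
    (fun u u' w => by simpa only [symp, h0] using (X.kform p).map_update_add ![u, w] 0 u u')
    (fun c u w => by simpa only [symp, h0] using (X.kform p).map_update_smul ![u, w] 0 c u)
    (fun u w w' => by simpa only [symp, h1] using (X.kform p).map_update_add ![u, w] 1 w w')
    (fun c u w => by simpa only [symp, h1] using (X.kform p).map_update_smul ![u, w] 1 c w)

theorem sympBilin_apply (p : Y) (u w : E) : X.sympBilin p u w = X.symp p u w := rfl

theorem isKahlerForm_sympBilin (p : Y) : IsKahlerForm (X.sympBilin p) where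
  self_eq_zero u := (X.kform p).map_eq_zero_of_eq ![u, u] (i := 0) (j := 1) rfl (by decide)
  invariant := X.kform_invariant p
  pos := X.kform_pos p

theorem volAt_ne_zero (p : Y) : X.volAt p ≠ 0 := fun h =>
  X.vol_ne_zero p (ContinuousAlternatingMap.toAlternatingMap_injective h)

/-- The Kähler form of the fibre through `p`, as a bilinear form on the vertical space. -/
def fiberBilin (p : Y) : LinearMap.BilinForm ℝ (X.Vert p) :=
  (X.sympBilin p).compl₁₂ ((X.Vert p).subtype.restrictScalars ℝ)
    ((X.Vert p).subtype.restrictScalars ℝ)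

theorem fiberBilin_apply (p : Y) (u w : X.Vert p) :
    X.fiberBilin p u w = X.sympBilin p u w := rfl

theorem isKahlerForm_fiberBilin (p : Y) : IsKahlerForm (X.fiberBilin p) where
  self_eq_zero u := (X.isKahlerForm_sympBilin p).self_eq_zero u
  invariant u w := (X.isKahlerForm_sympBilin p).invariant u w
  pos u hu := (X.isKahlerForm_sympBilin p).pos u fun h => hu (Subtype.ext h)

variable {X} {p : Y}

/-- The horizontal space is a complex line on which the Kähler form is a positive multiple of the
pullback of the area form under `dv`. -/
theorem IsHorizontal.symp_mul {x y h : E} (hx : X.IsHorizontal p x) (hy : X.IsHorizontal p y)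
    (hh : X.IsHorizontal p h) (h0 : X.dv p h ≠ 0) :
    X.sympBilin p x y * Complex.normSq (X.dv p h)
      = X.sympBilin p h (Complex.I • h) * areaForm (X.dv p x) (X.dv p y) := by
  have hσ := X.isKahlerForm_sympBilin p
  have hperp : ∀ {u}, X.IsHorizontal p u → ∀ w ∈ X.Vert p, X.sympBilin p u w = 0 :=
    fun hu w hw => hu w hw
  have hIperp : ∀ {u}, X.IsHorizontal p u → ∀ w ∈ X.Vert p,
      X.sympBilin p (Complex.I • u) w = 0 := fun hu w hw => by
    rw [hσ.I_left, hperp hu _ ((X.Vert p).smul_mem _ hw), neg_zero]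
  have hexp : ∀ (z : ℂ) (u : E), z • u = z.re • u + z.im • (Complex.I • u) := by
    intro z u
    conv_lhs => rw [← Complex.re_add_im z, add_smul, mul_smul]
    rfl
  -- horizontal vectors are complex multiples of `h`
  have hline : ∀ {u}, X.IsHorizontal p u → u = (X.dv p u / X.dv p h) • h := by
    intro u hu
    set z := X.dv p u / X.dv p h with hz
    have hker : u - z • h ∈ X.Vert p := by
      change X.dv p (u - z • h) = 0
      rw [map_sub, map_smul, smul_eq_mul, hz, div_mul_cancel₀ _ h0, sub_self]
    refine sub_eq_zero.1 (hσ.eq_zero_of_I_smul ?_)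
    have hw := (X.Vert p).smul_mem Complex.I hker
    have hzh : ∀ w ∈ X.Vert p, X.sympBilin p (z • h) w = 0 := fun w hw => by
      rw [hexp z h, map_add, LinearMap.add_apply, map_smul, map_smul, LinearMap.smul_apply,
        LinearMap.smul_apply, hperp hh _ hw, hIperp hh _ hw, smul_zero, smul_zero, add_zero]
    rw [map_sub, LinearMap.sub_apply, hperp hu _ hw, hzh _ hw, sub_zero]
  set a := X.dv p x / X.dv p h with ha
  set b := X.dv p y / X.dv p h with hb
  have hxa : X.dv p x = a * X.dv p h := by rw [ha, div_mul_cancel₀ _ h0]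
  have hyb : X.dv p y = b * X.dv p h := by rw [hb, div_mul_cancel₀ _ h0]
  rw [hxa, hyb, hline hx, hline hy, ← ha, ← hb, hexp a, hexp b]
  simp only [map_add, LinearMap.add_apply, map_smul, LinearMap.smul_apply, hσ.self_eq_zero,
    hσ.I_left, smul_eq_mul]
  rw [← hσ.invariant h, smul_smul Complex.I Complex.I, Complex.I_mul_I, neg_one_smul, map_neg,
    hσ.I_left]
  simp only [areaForm, Complex.mul_re, Complex.mul_im, Complex.normSq_apply]
  ring

theorem finrank_vert [FiniteDimensional ℂ E] (h : X.dv p ≠ 0) :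
    Module.finrank ℂ (X.Vert p) = n := by
  have h1 := LinearMap.finrank_range_add_finrank_ker (X.dv p : E →ₗ[ℂ] ℂ)
  have h2 : LinearMap.range (X.dv p : E →ₗ[ℂ] ℂ) = ⊤ := by
    refine LinearMap.range_eq_top.2 (LinearMap.surjective fun h0 => h ?_)
    exact ContinuousLinearMap.coe_injective h0
  rw [h2, finrank_top, X.dim_eq, Module.finrank_self] at h1
  change Module.finrank ℂ (LinearMap.ker (X.dv p : E →ₗ[ℂ] ℂ)) = n
  omega

/-- The frame of `T_p Y` obtained from a family of vertical vectors and one further vector. -/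
def extendFrame (u : Fin n → X.Vert p) (h : E) : Fin (n + 1) → E :=
  Fin.snoc (fun k => (u k : E)) h

theorem volAt_extendFrame (hp : X.dv p ≠ 0) (u : Fin n → X.Vert p) (h : E) :
    X.volAt p (extendFrame u h) = X.fiberVol p u * X.dv p h :=
  (X.fiberVol_mul_dv p hp u h).symm

theorem isotropic_extendFrame {u : Fin n → X.Vert p} (hu : ∀ j k, X.fiberBilin p (u j) (u k) = 0)
    {h : E} (hh : X.IsHorizontal p h) (j k : Fin (n + 1)) :
    X.sympBilin p (extendFrame u h j) (extendFrame u h k) = 0 := by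
  have hσ := X.isKahlerForm_sympBilin p
  have hhu : ∀ k, X.sympBilin p h (u k) = 0 := fun k => hh _ (u k).2
  refine Fin.lastCases ?_ (fun j => ?_) j <;> refine Fin.lastCases ?_ (fun k => ?_) k <;>
    simp only [extendFrame, Fin.snoc_last, Fin.snoc_castSucc]
  · exact hσ.self_eq_zero h
  · exact hhu k
  · rw [hσ.neg, hhu, neg_zero]
  · exact hu j k

/-- The orthogonal sum of a symplectic basis of the vertical space with a symplectic basis of the
horizontal line. -/
theorem isDarbouxPair_extendFrame {e f : Fin n → X.Vert p}
    (hef : IsDarbouxPair (X.fiberBilin p) e f) {x y : E} (hx : X.IsHorizontal p x)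
    (hy : X.IsHorizontal p y) (hxy : X.sympBilin p x y = 1) :
    IsDarbouxPair (X.sympBilin p) (extendFrame e x) (extendFrame f y) where
  left := isotropic_extendFrame hef.left hx
  right := isotropic_extendFrame hef.right hy
  pairing j k := by
    have hσ := X.isKahlerForm_sympBilin p
    have hxf : ∀ k, X.sympBilin p x (f k) = 0 := fun k => hx _ (f k).2
    have hye : ∀ k, X.sympBilin p y (e k) = 0 := fun k => hy _ (e k).2
    refine Fin.lastCases ?_ (fun j => ?_) j <;> refine Fin.lastCases ?_ (fun k => ?_) k <;>
      simp only [extendFrame, Fin.snoc_last, Fin.snoc_castSucc]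
    · simpa using hxy
    · rw [hxf, if_neg (Fin.castSucc_lt_last k).ne']
    · rw [hσ.neg, hye, neg_zero, if_neg (Fin.castSucc_lt_last j).ne]
    · rw [← X.fiberBilin_apply, hef.pairing]
      simp

theorem shortFrame_extendFrame (e f : Fin n → X.Vert p) (x y : E) (t : ℝ) :
    shortFrame (extendFrame e x) (extendFrame f y) t
      = extendFrame (shortFrame e f t)
        (Real.cos (Real.pi * t / 2) • x - Real.sin (Real.pi * t / 2) • y) := by
  funext j
  refine Fin.lastCases ?_ (fun j => ?_) j <;>
    simp only [shortFrame, extendFrame, Fin.snoc_last, Fin.snoc_castSucc]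
  rfl

theorem span_extendFrame_congr {u e : Fin n → X.Vert p}
    (hue : Submodule.span ℝ (Set.range u) = Submodule.span ℝ (Set.range e)) {h x : E}
    (hhx : Submodule.span ℝ {h} = Submodule.span ℝ {x}) :
    Submodule.span ℝ (Set.range (extendFrame u h))
      = Submodule.span ℝ (Set.range (extendFrame e x)) := by
  have key : ∀ w : Fin n → X.Vert p, Submodule.span ℝ (Set.range fun k => (w k : E))
      = (Submodule.span ℝ (Set.range w)).map ((X.Vert p).subtype.restrictScalars ℝ) := by
    intro w
    rw [Submodule.map_span, ← Set.range_comp]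
    rfl
  rw [extendFrame, extendFrame, span_range_snoc, span_range_snoc, key, key, hue, hhx]

/-- Additivity of canonical short paths: adapted frames of the fibre and of the base, with phase
lifts, combine to an adapted frame of the total space whose phase lift is the sum. -/
theorem exists_isPhaseLift_add [FiniteDimensional ℂ E] {u₀ u₁ : Fin n → X.Vert p} {h₀ h₁ : E}
    (hh₀ : X.IsHorizontal p h₀) (hh₁ : X.IsHorizontal p h₁)
    (hd₀ : X.dv p h₀ ≠ 0)
    {A : X.Vert p ≃ₗ[ℝ] (Fin n → ℂ)} {B : ℂ ≃ₗ[ℝ] (Fin 1 → ℂ)}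
    (hA : IsAdaptedFrame (fun u w => X.fiberBilin p u w) (Submodule.span ℝ (Set.range u₀))
      (Submodule.span ℝ (Set.range u₁)) A)
    (hB : IsAdaptedFrame (fun u w => areaBilin u w) (Submodule.span ℝ {X.dv p h₀})
      (Submodule.span ℝ {X.dv p h₁}) B)
    {φ ψ : ℝ} {θ ϑ : ℝ → ℝ} (hθ : IsPhaseLift (X.fiberVol p) A φ θ)
    (hϑ : IsPhaseLift dzForm B ψ ϑ) :
    ∃ C : E ≃ₗ[ℝ] (Fin (n + 1) → ℂ),
      IsAdaptedFrame (fun u w => X.sympBilin p u w)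
        (Submodule.span ℝ (Set.range (extendFrame u₀ h₀)))
        (Submodule.span ℝ (Set.range (extendFrame u₁ h₁))) C ∧
      IsPhaseLift (X.volAt p) C (φ + ψ) (fun t => θ t + ϑ t) := by
  have hσ := X.isKahlerForm_sympBilin p
  have hp : X.dv p ≠ 0 := by
    rintro h
    simp [h] at hd₀
  have hs₀ := eq_span_of_map_eq_rotatedReal hA.map_zero_side
  have hs₁ := eq_span_of_map_eq_rotatedReal hA.map_one_side
  have hD := hA.isDarbouxPair
  obtain ⟨hθc, hθ0, hθl⟩ := (isPhaseLift_iff hA).1 hθ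
  have hbs₀ := eq_span_of_map_eq_rotatedReal hB.map_zero_side
  have hbs₁ := eq_span_of_map_eq_rotatedReal hB.map_one_side
  have hbD := hB.isDarbouxPair
  obtain ⟨hϑc, hϑ0, hϑl⟩ := (isPhaseLift_iff hB).1 hϑ
  set e : Fin n → X.Vert p := fun k => A.symm (Pi.single k 1)
  set f : Fin n → X.Vert p := fun k => A.symm (Pi.single k Complex.I)
  set x : Fin 1 → ℂ := fun k => B.symm (Pi.single k 1) with hx
  set y : Fin 1 → ℂ := fun k => B.symm (Pi.single k Complex.I) with hy
  have hxy : areaForm (x 0) (y 0) = 1 := by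
    have := hbD.pairing 0 0
    rwa [if_pos rfl] at this
  rw [Set.range_unique] at hbs₀ hbs₁
  obtain ⟨r, hr⟩ : ∃ r : ℝ, r • X.dv p h₀ = x 0 := by
    rw [← Submodule.mem_span_singleton, hbs₀]
    exact Submodule.mem_span_singleton_self _
  obtain ⟨s, hs⟩ : ∃ s : ℝ, s • X.dv p h₁ = y 0 := by
    rw [← Submodule.mem_span_singleton, hbs₁]
    exact Submodule.mem_span_singleton_self _
  have hr0 : r ≠ 0 := by
    rintro rfl
    rw [zero_smul] at hr
    simp [areaForm, ← hr] at hxy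
  have hs0 : s ≠ 0 := by
    rintro rfl
    rw [zero_smul] at hs
    simp [areaForm, ← hs] at hxy
  -- the ratio of the Kähler form on the horizontal space to the pullback of the area form
  set κ : ℝ := X.sympBilin p h₀ (Complex.I • h₀) / Complex.normSq (X.dv p h₀) with hκ
  have hN : 0 < Complex.normSq (X.dv p h₀) := Complex.normSq_pos.2 hd₀
  have hκ0 : 0 < κ := div_pos (hσ.pos _ fun h => hd₀ (by rw [h, map_zero])) hN
  set c : ℝ := (Real.sqrt κ)⁻¹ with hc
  have hc0 : c ≠ 0 := inv_ne_zero (Real.sqrt_pos.2 hκ0).ne'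
  have hcκ : c * c * κ = 1 := by
    have h1 := Real.mul_self_sqrt hκ0.le
    have h2 := (Real.sqrt_pos.2 hκ0).ne'
    rw [hc]
    field_simp
    nlinarith
  have hdr : ∀ (a : ℝ) (w : E), X.dv p (a • w) = a • X.dv p w := fun a w =>
    (X.dv p).map_smul_of_tower a w
  have hhor : ∀ {h : E} (a : ℝ), X.IsHorizontal p h → X.IsHorizontal p (a • h) := by
    intro h a hh w hw
    rw [← X.sympBilin_apply, map_smul, LinearMap.smul_apply, X.sympBilin_apply, hh w hw,
      smul_zero]
  have hpair : X.sympBilin p ((c * r) • h₀) ((c * s) • h₁) = 1 := by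
    have h := (hhor r hh₀).symp_mul (hhor s hh₁) hh₀ hd₀
    rw [hdr, hdr, hr, hs, hxy, mul_one, ← eq_div_iff hN.ne', ← hκ] at h
    have hcc : ∀ u w : E, X.sympBilin p (c • u) (c • w) = c * c * X.sympBilin p u w :=
      fun u w => by
        simp only [map_smul, LinearMap.smul_apply, smul_eq_mul]
        ring
    rw [mul_smul, mul_smul, hcc, h, hcκ]
  have hT := isDarbouxPair_extendFrame hD (hhor (c * r) hh₀) (hhor (c * s) hh₁) hpair
  obtain ⟨C, hC, hCe, hCf⟩ := hT.exists_isAdaptedFrame hσ X.dim_eq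
  have hspan : ∀ (h : E) {a : ℝ}, a ≠ 0 →
      Submodule.span ℝ {h} = Submodule.span ℝ {a • h} := fun h a ha =>
    (Submodule.span_singleton_smul_eq (IsUnit.mk0 a ha) h).symm
  rw [← span_extendFrame_congr hs₀ (hspan h₀ (mul_ne_zero hc0 hr0)),
    ← span_extendFrame_congr hs₁ (hspan h₁ (mul_ne_zero hc0 hs0))] at hC
  refine ⟨C, hC, (isPhaseLift_iff hC).2 ⟨hθc.add hϑc, by rw [hθ0, hϑ0], fun t ht => ?_⟩⟩
  rw [hCe, hCf, shortFrame_extendFrame, volAt_extendFrame hp]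
  have hlast : X.dv p (Real.cos (Real.pi * t / 2) • (c * r) • h₀
      - Real.sin (Real.pi * t / 2) • (c * s) • h₁) = (c : ℂ) * dzForm (shortFrame x y t) := by
    rw [map_sub, hdr, hdr, hdr, hdr, mul_smul, mul_smul, hr, hs, dzForm_apply, shortFrame]
    simp only [Complex.real_smul]
    ring
  rw [hlast, squaredPhase_mul, squaredPhase_mul, squaredPhase_ofReal hc0, one_mul, ← hθl t ht,
    ← hϑl t ht, ← Complex.exp_add]
  push_cast
  ring_nf

end KahlerLGModel

/-! ### Closed forms along horizontal directions -/

/-- If the contraction of the pullback of a closed `2`-form with the last coordinate direction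
vanishes, then the pullback does not change in that direction. -/
theorem hasDerivAt_pullback_closed {P E : Type*} [NormedAddCommGroup P] [NormedSpace ℝ P]
    [NormedAddCommGroup E] [NormedSpace ℝ E] {F : P × ℝ → E} {Ω : E → E [⋀^Fin 2]→L[ℝ] ℝ}
    {x : P} {t : ℝ} (hF : ContDiffAt ℝ ∞ F (x, t)) (hΩ : DifferentiableAt ℝ Ω (F (x, t)))
    (hclosed : extDeriv Ω (F (x, t)) = 0)
    (hhor : ∀ᶠ z in 𝓝 (x, t), ∀ a : P,
      Ω (F z) ![fderiv ℝ F z (0, 1), fderiv ℝ F z (a, 0)] = 0) (a b : P) :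
    HasDerivAt (fun s => Ω (F (x, s)) ![fderiv ℝ F (x, s) (a, 0), fderiv ℝ F (x, s) (b, 0)])
      0 t := by
  let β : P × ℝ → (P × ℝ) [⋀^Fin 2]→L[ℝ] ℝ := fun z =>
    (Ω (F z)).compContinuousLinearMap (fderiv ℝ F z)
  have hβapp : ∀ z u w, β z ![u, w] = Ω (F z) ![fderiv ℝ F z u, fderiv ℝ F z w] := by
    intro z u w
    change Ω (F z) (fun i => fderiv ℝ F z (![u, w] i)) = _
    congr 1
    ext i
    fin_cases i <;> rfl
  have hβ : DifferentiableAt ℝ β (x, t) := by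
    refine DifferentiableAt.continuousAlternatingMapCompContinuousLinearMap
      (DifferentiableAt.comp (x, t) hΩ (hF.differentiableAt (by simp))) ?_
    exact (hF.fderiv_right (m := ∞) (by simp)).differentiableAt (by simp)
  have hd : extDeriv β (x, t) = 0 := by
    have := extDeriv_pullback hΩ hF (by
      rw [minSmoothness_of_isRCLikeNormedField]
      exact WithTop.coe_le_coe.2 (le_top : (2 : ℕ∞) ≤ ⊤))
    rw [hclosed] at this
    exact this
  have hzero : ∀ c : P, (fun z => β z ![(0, 1), (c, 0)]) =ᶠ[𝓝 (x, t)] fun _ => 0 := by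
    intro c
    filter_upwards [hhor] with z hz
    rw [hβapp, hz]
  have happ := extDeriv_apply hβ ![((0 : P), (1 : ℝ)), (a, 0), (b, 0)]
  have r0 : (0 : Fin 3).removeNth ![((0 : P), (1 : ℝ)), (a, 0), (b, 0)] = ![(a, 0), (b, 0)] := by
    ext i <;> fin_cases i <;> rfl
  have r1 : (1 : Fin 3).removeNth ![((0 : P), (1 : ℝ)), (a, 0), (b, 0)] = ![(0, 1), (b, 0)] := by
    ext i <;> fin_cases i <;> rfl
  have r2 : (2 : Fin 3).removeNth ![((0 : P), (1 : ℝ)), (a, 0), (b, 0)] = ![(0, 1), (a, 0)] := by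
    ext i <;> fin_cases i <;> rfl
  rw [hd, Fin.sum_univ_three, r0, r1, r2, (hzero a).fderiv_eq, (hzero b).fderiv_eq] at happ
  have hmain : fderiv ℝ (fun z => β z ![(a, 0), (b, 0)]) (x, t) (0, 1) = 0 := by
    simpa using happ.symm
  have hdiff : DifferentiableAt ℝ (fun z => β z ![(a, 0), (b, 0)]) (x, t) := by
    exact hβ.continuousAlternatingMap_apply_const _
  have hcurve : HasDerivAt (fun s : ℝ => (x, s)) ((0 : P), (1 : ℝ)) t :=
    (hasDerivAt_const t x).prodMk (hasDerivAt_id t)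
  have := hdiff.hasFDerivAt.comp_hasDerivAt t hcurve
  rw [hmain] at this
  simpa only [Function.comp_def, hβapp] using this

/-! ### Complex manifolds as real manifolds -/

theorem isManifold_real_of_complex {E Y : Type*} [NormedAddCommGroup E] [NormedSpace ℂ E]
    [TopologicalSpace Y] [ChartedSpace E Y] [IsManifold 𝓘(ℂ, E) ω Y] :
    IsManifold 𝓘(ℝ, E) ∞ Y := by
  refine isManifold_of_contDiffOn 𝓘(ℝ, E) ∞ Y fun e e' he he' => ?_
  have h := (contDiffGroupoid ω 𝓘(ℂ, E)).compatible he he'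
  rw [contDiffGroupoid, mem_groupoid_of_pregroupoid] at h
  exact (ContDiffOn.restrict_scalars ℝ h.1).of_le le_top

theorem HasMFDerivAt.restrictScalars_real {E Y : Type*} [NormedAddCommGroup E] [NormedSpace ℂ E]
    [TopologicalSpace Y] [ChartedSpace E Y] {E' Y' : Type*} [NormedAddCommGroup E']
    [NormedSpace ℂ E'] [TopologicalSpace Y'] [ChartedSpace E' Y'] {f : Y → Y'} {y : Y}
    {D : E →L[ℂ] E'} (h : HasMFDerivAt 𝓘(ℂ, E) 𝓘(ℂ, E') f y D) :
    HasMFDerivAt 𝓘(ℝ, E) 𝓘(ℝ, E') f y (D.restrictScalars ℝ) :=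
  ⟨h.1, HasFDerivWithinAt.restrictScalars ℝ h.2⟩

namespace FiberedLagrangian

variable {n : ℕ} {E Y : Type*} [NormedAddCommGroup E] [NormedSpace ℂ E]
  [TopologicalSpace Y] [ChartedSpace E Y] {X : KahlerLGModel n E Y}
  {ℓ : Type*} [TopologicalSpace ℓ] [ChartedSpace (EuclideanSpace ℝ (Fin n)) ℓ]
  (L : FiberedLagrangian X ℓ)

/-- The derivative at `(q, t)` of the embedding of `L` into `Y`. -/
def diff (q : ℓ) (t : ℝ) : EuclideanSpace ℝ (Fin n) × ℝ →L[ℝ] E :=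
  mfderiv ((𝓡 n).prod 𝓘(ℝ, ℝ)) 𝓘(ℝ, E) L.map (q, t)

/-- The velocity of the horizontal lift of `γ`. -/
def horizontalLift (q : ℓ) (t : ℝ) : E := L.diff q t (0, 1)

theorem hasMFDerivAt_map (q : ℓ) (t : ℝ) :
    HasMFDerivAt ((𝓡 n).prod 𝓘(ℝ, ℝ)) 𝓘(ℝ, E) L.map (q, t) (L.diff q t) :=
  ((L.map_smooth (q, t)).mdifferentiableAt (by simp)).hasMFDerivAt

theorem tangent_eq_range (q : ℓ) (t : ℝ) :
    L.tangent q t = LinearMap.range (L.diff q t).toLinearMap := rfl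

theorem mfderiv_slice (q : ℓ) (t : ℝ) :
    mfderiv (𝓡 n) 𝓘(ℝ, E) (fun q' => L.map (q', t)) q
      = (L.diff q t).comp (ContinuousLinearMap.inl ℝ (EuclideanSpace ℝ (Fin n)) ℝ) := by
  have h1 : HasMFDerivAt (𝓡 n) ((𝓡 n).prod 𝓘(ℝ, ℝ)) (fun q' : ℓ => (q', t)) q
      (ContinuousLinearMap.inl ℝ (EuclideanSpace ℝ (Fin n)) ℝ) :=
    (hasMFDerivAt_id q).prodMk (hasMFDerivAt_const t q)
  exact ((L.hasMFDerivAt_map q t).comp q h1).mfderiv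

theorem mem_fiberTangent {q : ℓ} {t : ℝ} {u : E} :
    u ∈ L.fiberTangent q t ↔ ∃ a, L.diff q t (a, 0) = u := by
  have : L.fiberTangent q t = LinearMap.range
      ((L.diff q t).comp (ContinuousLinearMap.inl ℝ (EuclideanSpace ℝ (Fin n)) ℝ)).toLinearMap := by
    rw [← L.mfderiv_slice q t]
    rfl
  rw [this]
  rfl

theorem isHorizontal_horizontalLift (q : ℓ) (t : ℝ) :
    X.IsHorizontal (L.map (q, t)) (L.horizontalLift q t) := by
  have h1 : HasMFDerivAt 𝓘(ℝ, ℝ) ((𝓡 n).prod 𝓘(ℝ, ℝ)) (fun s : ℝ => (q, s)) t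
      (ContinuousLinearMap.inr ℝ (EuclideanSpace ℝ (Fin n)) ℝ) :=
    (hasMFDerivAt_const q t).prodMk (hasMFDerivAt_id t)
  have h2 : mfderiv 𝓘(ℝ, ℝ) 𝓘(ℝ, E) (fun s => L.map (q, s)) t = _ :=
    ((L.hasMFDerivAt_map q t).comp t h1).mfderiv
  have h := L.horizontal q t
  rw [h2] at h
  exact h

theorem dv_diff [IsManifold 𝓘(ℂ, E) ω Y] (q : ℓ) (t : ℝ) (a : EuclideanSpace ℝ (Fin n)) (s : ℝ) :
    X.dv (L.map (q, t)) (L.diff q t (a, s)) = s • deriv L.γ t := by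
  have hv : HasMFDerivAt 𝓘(ℝ, E) 𝓘(ℝ, ℂ) X.v (L.map (q, t))
      ((X.dv (L.map (q, t))).restrictScalars ℝ) :=
    HasMFDerivAt.restrictScalars_real
      ((X.v_holomorphic _).mdifferentiableAt (by simp)).hasMFDerivAt
  have h1 := hv.comp (q, t) (L.hasMFDerivAt_map q t)
  have hγ : HasMFDerivAt 𝓘(ℝ, ℝ) 𝓘(ℝ, ℂ) L.γ t (fderiv ℝ L.γ t) :=
    ((L.γ_smooth.differentiable (by simp)) t).hasFDerivAt.hasMFDerivAt
  have h2 := hγ.comp (q, t) (hasMFDerivAt_snd (I := 𝓡 n) (I' := 𝓘(ℝ, ℝ)) (q, t))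
  have hfun : X.v ∘ L.map = L.γ ∘ Prod.snd := funext fun x => L.map_over x.1 x.2
  rw [hfun] at h1
  have h3 := hasMFDerivAt_unique h1 h2
  have h4 : X.dv (L.map (q, t)) (L.diff q t (a, s)) = fderiv ℝ L.γ t s :=
    congrArg (fun D : EuclideanSpace ℝ (Fin n) × ℝ →L[ℝ] ℂ => D (a, s)) h3
  rw [h4, fderiv_eq_smul_deriv]

theorem diff_mem_vert [IsManifold 𝓘(ℂ, E) ω Y] (q : ℓ) (t : ℝ) (a : EuclideanSpace ℝ (Fin n)) :
    L.diff q t (a, 0) ∈ X.Vert (L.map (q, t)) := by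
  change X.dv (L.map (q, t)) (L.diff q t (a, 0)) = 0
  rw [L.dv_diff, zero_smul]

theorem dv_horizontalLift [IsManifold 𝓘(ℂ, E) ω Y] (q : ℓ) (t : ℝ) :
    X.dv (L.map (q, t)) (L.horizontalLift q t) = deriv L.γ t := by
  rw [horizontalLift, L.dv_diff, one_smul]

theorem dv_ne_zero (q : ℓ) (t : ℝ) : X.dv (L.map (q, t)) ≠ 0 := fun h =>
  L.γ_regular t ⟨L.map (q, t), h, L.map_over q t⟩

/-! ### The embedding in charts -/

/-- The embedding of `L` in the preferred charts at `q` and at `y`. -/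
def localMap (q : ℓ) (y : Y) (z : EuclideanSpace ℝ (Fin n) × ℝ) : E :=
  extChartAt 𝓘(ℝ, E) y (L.map ((extChartAt (𝓡 n) q).symm z.1, z.2))

/-- The derivative at `x` of the inverse of the preferred chart at `q`. -/
def chartSymmDiff (q : ℓ) (x : EuclideanSpace ℝ (Fin n)) :
    EuclideanSpace ℝ (Fin n) →L[ℝ] EuclideanSpace ℝ (Fin n) :=
  mfderiv 𝓘(ℝ, EuclideanSpace ℝ (Fin n)) (𝓡 n) (extChartAt (𝓡 n) q).symm x

/-- The domain on which the chart expression `localMap` is meaningful. -/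
def localDomain (q : ℓ) (y : Y) : Set (EuclideanSpace ℝ (Fin n) × ℝ) :=
  {z | z.1 ∈ (extChartAt (𝓡 n) q).target ∧
    L.map ((extChartAt (𝓡 n) q).symm z.1, z.2) ∈ (extChartAt 𝓘(ℝ, E) y).source}

theorem isOpen_localDomain (q : ℓ) (y : Y) : IsOpen (L.localDomain q y) := by
  have h1 : ContinuousOn (fun z : EuclideanSpace ℝ (Fin n) × ℝ =>
      L.map ((extChartAt (𝓡 n) q).symm z.1, z.2)) (Prod.fst ⁻¹' (extChartAt (𝓡 n) q).target) := by
    refine L.map_smooth.continuous.comp_continuousOn (ContinuousOn.prodMk ?_ continuousOn_snd)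
    exact (continuousOn_extChartAt_symm q).comp continuousOn_fst fun z hz => hz
  exact h1.isOpen_inter_preimage ((isOpen_extChartAt_target q).preimage continuous_fst)
    (isOpen_extChartAt_source y)

theorem extChartAt_symm_localMap {q : ℓ} {y : Y} {z : EuclideanSpace ℝ (Fin n) × ℝ}
    (hz : z ∈ L.localDomain q y) : (extChartAt 𝓘(ℝ, E) y).symm (L.localMap q y z)
      = L.map ((extChartAt (𝓡 n) q).symm z.1, z.2) :=
  (extChartAt 𝓘(ℝ, E) y).left_inv hz.2

theorem localMap_mem_target {q : ℓ} {y : Y} {z : EuclideanSpace ℝ (Fin n) × ℝ}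
    (hz : z ∈ L.localDomain q y) : L.localMap q y z ∈ (extChartAt 𝓘(ℝ, E) y).target :=
  (extChartAt 𝓘(ℝ, E) y).map_source hz.2

theorem contDiffAt_localMap [IsManifold 𝓘(ℝ, E) ∞ Y] [IsManifold (𝓡 n) ∞ ℓ] {q : ℓ} {y : Y}
    {z : EuclideanSpace ℝ (Fin n) × ℝ} (hz : z ∈ L.localDomain q y) :
    ContDiffAt ℝ ∞ (L.localMap q y) z := by
  have h1 : ContMDiffAt 𝓘(ℝ, EuclideanSpace ℝ (Fin n)) (𝓡 n) ∞ (extChartAt (𝓡 n) q).symm z.1 :=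
    (contMDiffOn_extChartAt_symm q).contMDiffAt ((isOpen_extChartAt_target q).mem_nhds hz.1)
  have h2 : ContMDiffAt 𝓘(ℝ, EuclideanSpace ℝ (Fin n) × ℝ) ((𝓡 n).prod 𝓘(ℝ, ℝ)) ∞
      (fun z : EuclideanSpace ℝ (Fin n) × ℝ => ((extChartAt (𝓡 n) q).symm z.1, z.2)) z :=
    (ContMDiffAt.comp z h1 contDiffAt_fst.contMDiffAt).prodMk contDiffAt_snd.contMDiffAt
  have h3 := ContMDiffAt.comp z (L.map_smooth _) h2
  have h4 : ContMDiffAt 𝓘(ℝ, E) 𝓘(ℝ, E) ∞ (extChartAt 𝓘(ℝ, E) y)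
      (L.map ((extChartAt (𝓡 n) q).symm z.1, z.2)) :=
    contMDiffAt_extChartAt' (by rw [← extChartAt_source 𝓘(ℝ, E)]; exact hz.2)
  exact contMDiffAt_iff_contDiffAt.1 (ContMDiffAt.comp z h4 h3)

theorem mfderiv_extChartAt_symm_fderiv_localMap [IsManifold 𝓘(ℝ, E) ∞ Y]
    [IsManifold (𝓡 n) ∞ ℓ] {q : ℓ} {y : Y} {z : EuclideanSpace ℝ (Fin n) × ℝ}
    (hz : z ∈ L.localDomain q y) (a : EuclideanSpace ℝ (Fin n)) (s : ℝ) :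
    (mfderiv 𝓘(ℝ, E) 𝓘(ℝ, E) (extChartAt 𝓘(ℝ, E) y).symm (L.localMap q y z) : E →L[ℝ] E)
        (fderiv ℝ (L.localMap q y) z (a, s))
      = L.diff ((extChartAt (𝓡 n) q).symm z.1) z.2 (chartSymmDiff q z.1 a, s) := by
  have h1 : HasMFDerivAt 𝓘(ℝ, EuclideanSpace ℝ (Fin n)) (𝓡 n) (extChartAt (𝓡 n) q).symm z.1
      (chartSymmDiff q z.1) :=
    (((contMDiffOn_extChartAt_symm (n := ∞) q).contMDiffAt
      ((isOpen_extChartAt_target q).mem_nhds hz.1)).mdifferentiableAt (by simp)).hasMFDerivAt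
  have h2 : HasMFDerivAt 𝓘(ℝ, EuclideanSpace ℝ (Fin n) × ℝ) ((𝓡 n).prod 𝓘(ℝ, ℝ))
      (fun z : EuclideanSpace ℝ (Fin n) × ℝ => ((extChartAt (𝓡 n) q).symm z.1, z.2)) z
      (((chartSymmDiff q z.1).comp (ContinuousLinearMap.fst ℝ _ ℝ)).prod
        (ContinuousLinearMap.snd ℝ _ ℝ)) :=
    (HasMFDerivAt.comp z h1 (hasFDerivAt_fst.hasMFDerivAt)).prodMk
      (hasFDerivAt_snd.hasMFDerivAt)
  have h3 := HasMFDerivAt.comp z (L.hasMFDerivAt_map _ _) h2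
  have h4 : HasMFDerivAt 𝓘(ℝ, E) 𝓘(ℝ, E) (extChartAt 𝓘(ℝ, E) y).symm (L.localMap q y z)
      (mfderiv 𝓘(ℝ, E) 𝓘(ℝ, E) (extChartAt 𝓘(ℝ, E) y).symm (L.localMap q y z)) :=
    (((contMDiffOn_extChartAt_symm (n := ∞) y).contMDiffAt
      ((isOpen_extChartAt_target y).mem_nhds (L.localMap_mem_target hz))).mdifferentiableAt
        (by simp)).hasMFDerivAt
  have h5 := HasMFDerivAt.comp z h4
    (((L.contDiffAt_localMap hz).differentiableAt (by simp)).hasFDerivAt.hasMFDerivAt)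
  have hev : (extChartAt 𝓘(ℝ, E) y).symm ∘ L.localMap q y =ᶠ[𝓝 z]
      L.map ∘ fun z : EuclideanSpace ℝ (Fin n) × ℝ => ((extChartAt (𝓡 n) q).symm z.1, z.2) := by
    filter_upwards [(L.isOpen_localDomain q y).mem_nhds hz] with w hw
    exact L.extChartAt_symm_localMap hw
  have h6 := hasMFDerivAt_unique h5 (h3.congr_of_eventuallyEq hev)
  exact congrArg (fun D : EuclideanSpace ℝ (Fin n) × ℝ →L[ℝ] E => D (a, s)) h6

end FiberedLagrangian

namespace FiberedLagrangian

variable {n : ℕ} {E Y : Type*} [NormedAddCommGroup E] [NormedSpace ℂ E]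
  [TopologicalSpace Y] [ChartedSpace E Y] {X : KahlerLGModel n E Y}
  {ℓ : Type*} [TopologicalSpace ℓ] [ChartedSpace (EuclideanSpace ℝ (Fin n)) ℓ]
  (L : FiberedLagrangian X ℓ)

/-! ### Parallel transport preserves the Lagrangian condition -/

theorem isInvertible_chartSymmDiff [IsManifold (𝓡 n) ∞ ℓ] {q : ℓ}
    {x : EuclideanSpace ℝ (Fin n)} (hx : x ∈ (extChartAt (𝓡 n) q).target) :
    (chartSymmDiff q x).IsInvertible := by
  have : IsManifold (𝓡 n) 1 ℓ := IsManifold.of_le (n := ∞) (by simp)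
  have h := isInvertible_mfderivWithin_extChartAt_symm (I := 𝓡 n) hx
  rw [ModelWithCorners.range_eq_univ, mfderivWithin_univ] at h
  exact h

theorem mem_localDomain (q : ℓ) (t : ℝ) :
    (extChartAt (𝓡 n) q q, t) ∈ L.localDomain q (L.map (q, t)) := by
  refine ⟨mem_extChartAt_target q, ?_⟩
  rw [extChartAt_to_inv]
  exact mem_extChartAt_source _

theorem chartForm_kform_localMap [IsManifold 𝓘(ℝ, E) ∞ Y] [IsManifold (𝓡 n) ∞ ℓ] {q : ℓ} {y : Y}
    {z : EuclideanSpace ℝ (Fin n) × ℝ} (hz : z ∈ L.localDomain q y)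
    (a b : EuclideanSpace ℝ (Fin n)) (r s : ℝ) :
    chartForm ℝ X.kform y (L.localMap q y z)
        ![fderiv ℝ (L.localMap q y) z (a, r), fderiv ℝ (L.localMap q y) z (b, s)]
      = X.symp (L.map ((extChartAt (𝓡 n) q).symm z.1, z.2))
        (L.diff ((extChartAt (𝓡 n) q).symm z.1) z.2 (chartSymmDiff q z.1 a, r))
        (L.diff ((extChartAt (𝓡 n) q).symm z.1) z.2 (chartSymmDiff q z.1 b, s)) := by
  rw [← L.mfderiv_extChartAt_symm_fderiv_localMap hz, ← L.mfderiv_extChartAt_symm_fderiv_localMap hz,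
    ← L.extChartAt_symm_localMap hz]
  change X.kform _ (fun i => _) = X.kform _ _
  congr 1
  ext i
  fin_cases i <;> rfl

theorem symp_horizontalLift_diff [IsManifold 𝓘(ℂ, E) ω Y] (q : ℓ) (t : ℝ)
    (a : EuclideanSpace ℝ (Fin n)) :
    X.symp (L.map (q, t)) (L.diff q t (0, 1)) (L.diff q t (a, 0)) = 0 :=
  L.isHorizontal_horizontalLift q t _ (L.diff_mem_vert q t a)

/-- The pullback of the Kähler form to `ℓ × ℝ` is closed and its contraction with the `ℝ`-direction
vanishes by horizontality, so it is constant along that direction; it vanishes on the initial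
Lagrangian. -/
theorem symp_diff_diff_eq_zero [IsManifold 𝓘(ℂ, E) ω Y] [IsManifold (𝓡 n) ∞ ℓ] (q : ℓ) (t : ℝ)
    (a b : EuclideanSpace ℝ (Fin n)) :
    X.symp (L.map (q, t)) (L.diff q t (a, 0)) (L.diff q t (b, 0)) = 0 := by
  have hY : IsManifold 𝓘(ℝ, E) ∞ Y := isManifold_real_of_complex
  have key : ∀ t, HasDerivAt
      (fun s => X.symp (L.map (q, s)) (L.diff q s (a, 0)) (L.diff q s (b, 0))) 0 t := by
    intro t
    set y := L.map (q, t) with hy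
    set x := extChartAt (𝓡 n) q q with hx
    have hz : (x, t) ∈ L.localDomain q y := L.mem_localDomain q t
    have hopen := L.isOpen_localDomain q y
    obtain ⟨M, hM⟩ := isInvertible_chartSymmDiff hz.1
    have hMa : ∀ c, chartSymmDiff q x (M.symm c) = c := fun c => by
      rw [← hM]
      exact M.apply_symm_apply c
    have htarget := (isOpen_extChartAt_target (I := 𝓘(ℝ, E)) y).mem_nhds (L.localMap_mem_target hz)
    have hd := hasDerivAt_pullback_closed (L.contDiffAt_localMap hz)
      (((X.kform_smooth y).contDiffAt htarget).differentiableAt (by simp))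
      (X.kform_closed y _ (L.localMap_mem_target hz)) (by
        filter_upwards [hopen.mem_nhds hz] with z hz' c
        rw [L.chartForm_kform_localMap hz', map_zero]
        exact L.symp_horizontalLift_diff _ _ _) (M.symm a) (M.symm b)
    refine hd.congr_of_eventuallyEq ?_
    have hcont : Continuous fun s : ℝ => (x, s) := by fun_prop
    filter_upwards [(hopen.preimage hcont).mem_nhds hz] with s hs
    rw [L.chartForm_kform_localMap hs, hMa, hMa, hx, extChartAt_to_inv]
  have hconst := is_const_of_deriv_eq_zero (fun t => (key t).differentiableAt)
    (fun t => (key t).deriv) t 0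
  refine hconst.trans ?_
  have hmem : ∀ c, (⟨L.diff q 0 (c, 0), L.diff_mem_vert q 0 c⟩ : X.Vert (L.map (q, 0))) ∈
      X.vertPart (L.map (q, 0)) (tangentImage (𝓡 n) (fun q' => L.map (q', 0)) q) := fun c =>
    L.mem_fiberTangent.2 ⟨c, rfl⟩
  exact (L.initial_lagrangian q _).1 (hmem a) _ (hmem b)

/-! ### Frames of the tangent spaces of a fibered Lagrangian -/

theorem diff_injective (q : ℓ) (t : ℝ) : Function.Injective (L.diff q t) :=
  L.map_immersion (q, t)

/-- The frame of the tangent space of `L_{γ t}` at `map (q, t)` which is the image of the standard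
basis. -/
def vertFrame [IsManifold 𝓘(ℂ, E) ω Y] (q : ℓ) (t : ℝ) (k : Fin n) : X.Vert (L.map (q, t)) :=
  ⟨L.diff q t (EuclideanSpace.basisFun (Fin n) ℝ k, 0), L.diff_mem_vert q t _⟩

/-- The frame of the tangent space of `L` formed by a frame of the tangent space of the fibre and
the horizontal lift of the velocity of `γ`. -/
def frame [IsManifold 𝓘(ℂ, E) ω Y] (q : ℓ) (t : ℝ) : Fin (n + 1) → E :=
  KahlerLGModel.extendFrame (L.vertFrame q t) (L.horizontalLift q t)

/-- The standard basis of `ℝⁿ × ℝ`. -/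
def prodBasis (n : ℕ) : Module.Basis (Fin (n + 1)) ℝ (EuclideanSpace ℝ (Fin n) × ℝ) :=
  ((EuclideanSpace.basisFun (Fin n) ℝ).toBasis.prod (Module.Basis.singleton (Fin 1) ℝ)).reindex
    finSumFinEquiv

theorem prodBasis_castSucc (k : Fin n) :
    prodBasis n k.castSucc = (EuclideanSpace.basisFun (Fin n) ℝ k, 0) := by
  rw [prodBasis, Module.Basis.reindex_apply, show k.castSucc = Fin.castAdd 1 k from rfl,
    finSumFinEquiv_symm_apply_castAdd]
  simp [Module.Basis.prod_apply]

theorem prodBasis_last : prodBasis n (Fin.last n) = (0, 1) := by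
  rw [prodBasis, Module.Basis.reindex_apply, show Fin.last n = Fin.natAdd n (0 : Fin 1) from rfl,
    finSumFinEquiv_symm_apply_natAdd]
  simp [Module.Basis.prod_apply]

theorem linearIndependent_diff_basis (q : ℓ) (t : ℝ)
    (b : Module.Basis (Fin (n + 1)) ℝ (EuclideanSpace ℝ (Fin n) × ℝ)) :
    LinearIndependent ℝ fun j => L.diff q t (b j) :=
  b.linearIndependent.map' (L.diff q t).toLinearMap
    (LinearMap.ker_eq_bot.2 (L.diff_injective q t))

theorem span_diff_basis (q : ℓ) (t : ℝ)
    (b : Module.Basis (Fin (n + 1)) ℝ (EuclideanSpace ℝ (Fin n) × ℝ)) :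
    Submodule.span ℝ (Set.range fun j => L.diff q t (b j)) = L.tangent q t := by
  rw [L.tangent_eq_range, LinearMap.range_eq_map, ← b.span_eq, Submodule.map_span, ← Set.range_comp]
  rfl

theorem isSquaredPhase_base_iff (t : ℝ) (z : ℂ) :
    IsSquaredPhase dzForm (L.baseTangent t) z ↔ z = squaredPhase (deriv L.γ t) := by
  have hv : LinearIndependent ℝ (fun _ : Fin 1 => deriv L.γ t) :=
    LinearIndependent.of_subsingleton 0 (L.γ_immersion t)
  have h := isSquaredPhase_span_iff dzForm hv (z := z)
  rwa [Set.range_const, dzForm_apply] at h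

variable [IsManifold 𝓘(ℂ, E) ω Y]

theorem frame_eq (q : ℓ) (t : ℝ) : L.frame q t = fun j => L.diff q t (prodBasis n j) := by
  funext j
  refine Fin.lastCases ?_ (fun k => ?_) j
  · rw [frame, KahlerLGModel.extendFrame, Fin.snoc_last, prodBasis_last, horizontalLift]
  · rw [frame, KahlerLGModel.extendFrame, Fin.snoc_castSucc, prodBasis_castSucc]
    rfl

theorem span_frame (q : ℓ) (t : ℝ) :
    Submodule.span ℝ (Set.range (L.frame q t)) = L.tangent q t := by
  rw [frame_eq, L.span_diff_basis]

theorem linearIndependent_frame (q : ℓ) (t : ℝ) : LinearIndependent ℝ (L.frame q t) := by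
  rw [frame_eq]
  exact L.linearIndependent_diff_basis q t _

theorem linearIndependent_vertFrame (q : ℓ) (t : ℝ) : LinearIndependent ℝ (L.vertFrame q t) := by
  have h := L.linearIndependent_frame q t
  rw [frame, KahlerLGModel.extendFrame, linearIndependent_finSnoc] at h
  exact LinearIndependent.of_comp ((X.Vert (L.map (q, t))).subtype.restrictScalars ℝ) h.1

theorem span_vertFrame (q : ℓ) (t : ℝ) :
    Submodule.span ℝ (Set.range (L.vertFrame q t))
      = X.vertPart (L.map (q, t)) (L.fiberTangent q t) := by
  ext u
  rw [Submodule.mem_span_range_iff_exists_fun]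
  change _ ↔ (u : E) ∈ L.fiberTangent q t
  rw [L.mem_fiberTangent]
  have hsum : ∀ c : Fin n → ℝ, ((∑ k, c k • L.vertFrame q t k : X.Vert (L.map (q, t))) : E)
      = L.diff q t (∑ k, c k • EuclideanSpace.basisFun (Fin n) ℝ k, 0) := by
    intro c
    have : ((∑ k, c k • EuclideanSpace.basisFun (Fin n) ℝ k, 0) : EuclideanSpace ℝ (Fin n) × ℝ)
        = ∑ k, c k • ((EuclideanSpace.basisFun (Fin n) ℝ k, 0) : EuclideanSpace ℝ (Fin n) × ℝ) := by
      ext <;> simp [Prod.fst_sum, Prod.snd_sum]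
    rw [this, map_sum]
    simp only [map_smul]
    exact map_sum ((X.Vert (L.map (q, t))).subtype.restrictScalars ℝ) _ _
  constructor
  · rintro ⟨c, rfl⟩
    exact ⟨_, (hsum c).symm⟩
  · rintro ⟨a, ha⟩
    refine ⟨fun k => (EuclideanSpace.basisFun (Fin n) ℝ).repr a k, Subtype.ext ?_⟩
    rw [hsum, ← ha, (EuclideanSpace.basisFun (Fin n) ℝ).sum_repr]

theorem isotropic_vertFrame [IsManifold (𝓡 n) ∞ ℓ] (q : ℓ) (t : ℝ) (j k : Fin n) :
    X.fiberBilin (L.map (q, t)) (L.vertFrame q t j) (L.vertFrame q t k) = 0 :=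
  L.symp_diff_diff_eq_zero q t _ _

theorem isotropic_frame [IsManifold (𝓡 n) ∞ ℓ] (q : ℓ) (t : ℝ) (j k : Fin (n + 1)) :
    X.sympBilin (L.map (q, t)) (L.frame q t j) (L.frame q t k) = 0 :=
  KahlerLGModel.isotropic_extendFrame (L.isotropic_vertFrame q t)
    (L.isHorizontal_horizontalLift q t) j k

theorem volAt_frame_ne_zero [FiniteDimensional ℂ E] [IsManifold (𝓡 n) ∞ ℓ] (q : ℓ) (t : ℝ) :
    X.volAt (L.map (q, t)) (L.frame q t) ≠ 0 :=
  (X.isKahlerForm_sympBilin _).volume_ne_zero X.dim_eq (X.volAt_ne_zero _)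
    (L.linearIndependent_frame q t) (L.isotropic_frame q t)

theorem volAt_frame (q : ℓ) (t : ℝ) : X.volAt (L.map (q, t)) (L.frame q t)
    = X.fiberVol (L.map (q, t)) (L.vertFrame q t) * deriv L.γ t := by
  rw [frame, KahlerLGModel.volAt_extendFrame (L.dv_ne_zero q t), L.dv_horizontalLift]

theorem isSquaredPhase_fiber_iff (q : ℓ) (t : ℝ) (z : ℂ) :
    IsSquaredPhase (X.fiberVol (L.map (q, t)))
      (X.vertPart (L.map (q, t)) (L.fiberTangent q t)) z
      ↔ z = squaredPhase (X.fiberVol (L.map (q, t)) (L.vertFrame q t)) := by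
  rw [← L.span_vertFrame]
  exact isSquaredPhase_span_iff _ (L.linearIndependent_vertFrame q t)

theorem isSquaredPhase_tangent_iff (q : ℓ) (t : ℝ) (z : ℂ) :
    IsSquaredPhase (X.volAt (L.map (q, t))) (L.tangent q t) z
      ↔ z = squaredPhase (X.volAt (L.map (q, t)) (L.frame q t)) := by
  rw [← L.span_frame]
  exact isSquaredPhase_span_iff _ (L.linearIndependent_frame q t)

end FiberedLagrangian

/-! ### Smooth lifts of phase functions -/

section SmoothLifts

variable {B H M : Type*} [NormedAddCommGroup B] [NormedSpace ℝ B] [TopologicalSpace H]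
  {I : ModelWithCorners ℝ B H} [TopologicalSpace M] [ChartedSpace H M]

/-- A continuous lift of a smooth phase function is smooth: near each point it is given by a branch
of the logarithm. -/
theorem contMDiff_of_exp_eq {s : M → ℂ} (hs : ContMDiff I 𝓘(ℝ, ℂ) ∞ s) {α : M → ℝ}
    (hα : Continuous α) (h : ∀ x, Complex.exp (2 * Real.pi * Complex.I * α x) = s x) :
    ContMDiff I 𝓘(ℝ, ℝ) ∞ α := by
  intro x₀
  have hs0 : s x₀ ≠ 0 := by
    rw [← h]
    exact Complex.exp_ne_zero _
  let g : ℂ → ℝ := fun w => α x₀ + (Complex.log (w * (s x₀)⁻¹)).im / (2 * Real.pi)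
  have hg : ContDiffAt ℝ ∞ g (s x₀) := by
    have h1 : ContDiffAt ℝ ∞ Complex.log (s x₀ * (s x₀)⁻¹) := by
      rw [mul_inv_cancel₀ hs0]
      exact (Complex.contDiffAt_log Complex.one_mem_slitPlane).restrict_scalars ℝ
    have h2 : ContDiffAt ℝ ∞ (fun w : ℂ => Complex.log (w * (s x₀)⁻¹)) (s x₀) :=
      ContDiffAt.comp (s x₀) h1 (contDiffAt_id.mul contDiffAt_const)
    exact contDiffAt_const.add
      ((Complex.imCLM.contDiff.contDiffAt.comp (s x₀) h2).div_const _)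
  refine (ContDiffAt.comp_contMDiffAt hg (hs x₀)).congr_of_eventuallyEq ?_
  have hball : ∀ᶠ x in 𝓝 x₀, |α x - α x₀| < 1 / 2 := by
    have := hα.continuousAt (x := x₀)
    rw [Metric.continuousAt_iff'] at this
    simpa [Real.dist_eq] using this (1 / 2) (by norm_num)
  filter_upwards [hball] with x hx
  have hπ := Real.pi_pos
  rw [abs_lt] at hx
  have hlog : Complex.log (s x * (s x₀)⁻¹)
      = ((2 * Real.pi * (α x - α x₀) : ℝ) : ℂ) * Complex.I := by
    have hexp : s x * (s x₀)⁻¹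
        = Complex.exp (((2 * Real.pi * (α x - α x₀) : ℝ) : ℂ) * Complex.I) := by
      rw [← h, ← h, ← Complex.exp_neg, ← Complex.exp_add]
      push_cast
      ring_nf
    rw [hexp, Complex.log_exp]
    · rw [Complex.mul_I_im, Complex.ofReal_re]
      nlinarith
    · rw [Complex.mul_I_im, Complex.ofReal_re]
      nlinarith
  change α x = α x₀ + (Complex.log (s x * (s x₀)⁻¹)).im / (2 * Real.pi)
  rw [hlog, Complex.mul_I_im, Complex.ofReal_re]
  field_simp
  ring

/-- A phase function on a product with `ℝ` lifts as soon as it lifts on one slice: the homotopy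
`(σ, q, t) ↦ (q, t₀ + σ (t - t₀))` contracts the product onto the slice. -/
theorem exists_continuous_phase_lift {N : M × ℝ → ℂ} (hN0 : ∀ x, N x ≠ 0)
    (hN : Continuous fun x => squaredPhase (N x)) {t₀ : ℝ} {a : M → ℝ} (ha : Continuous a)
    (haN : ∀ q, Complex.exp (2 * Real.pi * Complex.I * a q) = squaredPhase (N (q, t₀))) :
    ∃ α : M × ℝ → ℝ, Continuous α ∧ (∀ q, α (q, t₀) = a q) ∧
      ∀ x, Complex.exp (2 * Real.pi * Complex.I * α x) = squaredPhase (N x) := by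
  let K : unitInterval × (M × ℝ) → M × ℝ := fun x => (x.2.1, t₀ + x.1 * (x.2.2 - t₀))
  have hK : Continuous K := by fun_prop
  let F : C(unitInterval × (M × ℝ), Circle) :=
    ⟨fun x => circlePhase (N (K x)) (hN0 _), (hN.comp hK).subtype_mk _⟩
  let f : C(M × ℝ, ℝ) := ⟨fun x => 2 * Real.pi * a x.1, by fun_prop⟩
  have hFf : ∀ x, F (0, x) = Circle.exp (f x) := by
    intro x
    have h0 : K (0, x) = (x.1, t₀) := by simp [K]
    refine Eq.trans ?_ (circleExp_two_pi_mul_eq (hN0 (x.1, t₀)) (haN x.1)).symm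
    change circlePhase (N (K (0, x))) (hN0 _) = _
    simp only [h0]
  let Γ := Circle.isCoveringMap_exp.liftHomotopy F f hFf
  have hΓ : Circle.exp ∘ Γ = F := Circle.isCoveringMap_exp.liftHomotopy_lifts F f hFf
  have hΓ0 : ∀ x, Γ (0, x) = f x := Circle.isCoveringMap_exp.liftHomotopy_zero F f hFf
  have hπ : (2 * Real.pi) ≠ 0 := by positivity
  refine ⟨fun x => Γ (1, x) / (2 * Real.pi), by fun_prop, fun q => ?_, fun x => ?_⟩
  · have hKq : ∀ σ : unitInterval, K (σ, (q, t₀)) = (q, t₀) := fun σ => by simp [K]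
    -- over the slice the homotopy is stationary, and so is its lift
    have hconst : (fun σ : unitInterval => Γ (σ, (q, t₀))) = fun _ => f (q, t₀) := by
      refine Circle.isCoveringMap_exp.eq_of_comp_eq (by fun_prop) continuous_const ?_ 0
        (hΓ0 (q, t₀))
      funext σ
      change (Circle.exp ∘ Γ) (σ, (q, t₀)) = _
      rw [hΓ, Function.comp_apply, ← hFf]
      change circlePhase (N (K (σ, (q, t₀)))) (hN0 _) = circlePhase (N (K (0, (q, t₀)))) (hN0 _)
      simp only [hKq]
    have := congrFun hconst 1
    change Γ (1, (q, t₀)) / (2 * Real.pi) = a q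
    rw [show Γ (1, (q, t₀)) = 2 * Real.pi * a q from this]
    field_simp
  · have h1 : K (1, x) = x := by simp [K]
    refine exp_two_pi_mul_eq_of_circleExp (hz := hN0 x) ?_
    rw [mul_div_cancel₀ _ hπ]
    refine (congrFun hΓ (1, x)).trans ?_
    change circlePhase (N (K (1, x))) (hN0 _) = _
    simp only [h1]

end SmoothLifts

theorem contDiffAt_squaredPhase {w : ℂ} (hw : w ≠ 0) : ContDiffAt ℝ ∞ squaredPhase w := by
  have h1 : ContDiffAt ℝ ∞ (fun z : ℂ => ((‖z‖ ^ 2 : ℝ) : ℂ)) w :=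
    Complex.ofRealCLM.contDiff.contDiffAt.comp w (contDiffAt_id.norm_sq ℝ)
  have h2 : ((‖w‖ ^ 2 : ℝ) : ℂ) ≠ 0 := by
    exact_mod_cast pow_ne_zero _ (norm_ne_zero_iff.2 hw)
  have h3 := (contDiffAt_id.pow 2).mul (h1.inv h2)
  exact h3.congr_of_eventuallyEq (Filter.Eventually.of_forall fun z => by
    simp [squaredPhase, div_eq_mul_inv])

/-- Evaluating a smooth family of complex volume forms on smooth families of vectors. -/
theorem contDiffAt_volume {W E : Type*} [NormedAddCommGroup W] [NormedSpace ℝ W]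
    [NormedAddCommGroup E] [NormedSpace ℂ E] [FiniteDimensional ℂ E] {m : ℕ}
    (hE : Module.finrank ℂ E = m) {Θ : E → E [⋀^Fin m]→L[ℂ] ℂ} {F : W → E}
    {u : W → Fin m → E} {z : W} (hΘ : ContDiffAt ℂ ∞ Θ (F z)) (hF : ContDiffAt ℝ ∞ F z)
    (hu : ∀ j, ContDiffAt ℝ ∞ (fun z => u z j) z) :
    ContDiffAt ℝ ∞ (fun z => Θ (F z) (u z)) z := by
  let b : Module.Basis (Fin m) ℂ E := Module.finBasisOfFinrankEq ℂ E hE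
  have happ : ∀ z, Θ (F z) (u z) = Θ (F z) b * (b.toMatrix (u z)).det := fun z => by
    have := (Θ (F z)).toAlternatingMap.eq_smul_basis_det b
    exact congrArg (fun g => g (u z)) this
  have h1 : ContDiffAt ℝ ∞ (fun z => Θ (F z) b) z := by
    have h := (ContinuousAlternatingMap.apply ℂ E ℂ (b : Fin m → E)).contDiff.contDiffAt.comp _ hΘ
    exact (ContDiffAt.restrict_scalars ℝ h).comp z hF
  have h2 : ContDiffAt ℝ ∞ (fun z => (b.toMatrix (u z)).det) z := by
    simp only [Matrix.det_apply]
    refine ContDiffAt.sum fun τ _ => ContDiffAt.const_smul _ (contDiffAt_prod fun i _ => ?_)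
    have hc : ContDiff ℝ ∞ (b.coord (τ i)) :=
      ((b.coord (τ i)).toContinuousLinearMap.restrictScalars ℝ).contDiff
    exact hc.contDiffAt.comp z (hu i)
  exact (h1.mul h2).congr_of_eventuallyEq (Filter.Eventually.of_forall happ)

namespace FiberedLagrangian

variable {n : ℕ} {E Y : Type*} [NormedAddCommGroup E] [NormedSpace ℂ E]
  [TopologicalSpace Y] [ChartedSpace E Y] {X : KahlerLGModel n E Y}
  {ℓ : Type*} [TopologicalSpace ℓ] [ChartedSpace (EuclideanSpace ℝ (Fin n)) ℓ]
  (L : FiberedLagrangian X ℓ)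

/-! ### Gradings of fibered Lagrangians -/

theorem exists_isBaseGrading : ∃ b, L.IsBaseGrading b := by
  have hγ : ContDiff ℝ ∞ (deriv L.γ) := (contDiff_infty_iff_deriv.1 L.γ_smooth).2
  have h0 := L.γ_immersion
  have hs : ContDiff ℝ ∞ fun t => squaredPhase (deriv L.γ t) := contDiff_iff_contDiffAt.2 fun t =>
    (contDiffAt_squaredPhase (h0 t)).comp t hγ.contDiffAt
  obtain ⟨b, hb, -, hbl⟩ := exists_continuous_phase_lift (M := Unit) (t₀ := 0)
    (N := fun x => deriv L.γ x.2) (a := fun _ => Complex.arg (squaredPhase (deriv L.γ 0))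
      / (2 * Real.pi)) (fun x => h0 x.2) (hs.continuous.comp continuous_snd) continuous_const
      (fun _ => by
        have hπ : (Real.pi : ℂ) ≠ 0 := by exact_mod_cast Real.pi_ne_zero
        have h := Complex.norm_mul_exp_arg_mul_I (squaredPhase (deriv L.γ 0))
        rw [norm_squaredPhase (h0 0), Complex.ofReal_one, one_mul] at h
        refine Eq.trans ?_ h
        congr 1
        push_cast
        field_simp)
  refine ⟨fun t => b ((), t), ?_, fun t => (L.isSquaredPhase_base_iff t _).2 (hbl ((), t))⟩
  exact (contMDiff_of_exp_eq hs.contMDiff (hb.comp (by fun_prop)) fun t => hbl ((), t)).contDiff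

variable [IsManifold 𝓘(ℂ, E) ω Y]

/-- The squared phase function of a fibered Lagrangian. -/
def phase (x : ℓ × ℝ) : ℂ := squaredPhase (X.volAt (L.map x) (L.frame x.1 x.2))

theorem mfderiv_complex_extChartAt_symm {y : Y} {w : E}
    (hw : w ∈ (extChartAt 𝓘(ℝ, E) y).target) (u : E) :
    (mfderiv 𝓘(ℂ, E) 𝓘(ℂ, E) (extChartAt 𝓘(ℂ, E) y).symm w : E →L[ℂ] E) u
      = (mfderiv 𝓘(ℝ, E) 𝓘(ℝ, E) (extChartAt 𝓘(ℝ, E) y).symm w : E →L[ℝ] E) u := by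
  have h : HasMFDerivAt 𝓘(ℂ, E) 𝓘(ℂ, E) (extChartAt 𝓘(ℂ, E) y).symm w
      (mfderiv 𝓘(ℂ, E) 𝓘(ℂ, E) (extChartAt 𝓘(ℂ, E) y).symm w) :=
    (((contMDiffOn_extChartAt_symm (n := ω) y).contMDiffAt
      ((isOpen_extChartAt_target (I := 𝓘(ℂ, E)) y).mem_nhds hw)).mdifferentiableAt
        (by simp)).hasMFDerivAt
  have h' : mfderiv 𝓘(ℝ, E) 𝓘(ℝ, E) (extChartAt 𝓘(ℝ, E) y).symm w = _ :=
    (HasMFDerivAt.restrictScalars_real h).mfderiv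
  rw [h']
  rfl

theorem contMDiff_phase [FiniteDimensional ℂ E] [IsManifold (𝓡 n) ∞ ℓ] :
    ContMDiff ((𝓡 n).prod 𝓘(ℝ, ℝ)) 𝓘(ℝ, ℂ) ∞ L.phase := by
  have hY : IsManifold 𝓘(ℝ, E) ∞ Y := isManifold_real_of_complex
  rintro ⟨q, t⟩
  set y := L.map (q, t) with hy
  set z₀ : EuclideanSpace ℝ (Fin n) × ℝ := (extChartAt (𝓡 n) q q, t) with hz₀
  have hz : z₀ ∈ L.localDomain q y := L.mem_localDomain q t
  let N : EuclideanSpace ℝ (Fin n) × ℝ → ℂ := fun z =>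
    chartForm ℂ X.vol y (L.localMap q y z)
      (fun j => fderiv ℝ (L.localMap q y) z (prodBasis n j))
  -- the chart expression of the phase; the chart of `ℓ` only changes the frame by a real matrix
  have hN : ∀ z ∈ L.localDomain q y,
      squaredPhase (N z) = L.phase ((extChartAt (𝓡 n) q).symm z.1, z.2) := by
    intro z hz
    obtain ⟨M, hM⟩ := isInvertible_chartSymmDiff hz.1
    let b := (prodBasis n).map (M.prodCongr (ContinuousLinearEquiv.refl ℝ ℝ)).toLinearEquiv
    have hb : ∀ j, b j = (chartSymmDiff q z.1 (prodBasis n j).1, (prodBasis n j).2) := fun j => by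
      rw [← hM]
      rfl
    have hNz : N z = X.volAt (L.map ((extChartAt (𝓡 n) q).symm z.1, z.2))
        (fun j => L.diff ((extChartAt (𝓡 n) q).symm z.1) z.2 (b j)) := by
      simp only [hb, ← L.mfderiv_extChartAt_symm_fderiv_localMap hz, Prod.mk.eta,
        ← mfderiv_complex_extChartAt_symm (L.localMap_mem_target hz)]
      rw [← L.extChartAt_symm_localMap hz]
      rfl
    rw [hNz, phase]
    refine squaredPhase_eq_of_span_eq _ (L.linearIndependent_diff_basis _ _ b)
      (L.linearIndependent_frame _ _) ?_
    rw [L.span_diff_basis, L.span_frame]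
  have hNs : ContDiffAt ℝ ∞ N z₀ := by
    refine contDiffAt_volume X.dim_eq (((X.vol_holomorphic y).contDiffAt
      ((isOpen_extChartAt_target (I := 𝓘(ℂ, E)) y).mem_nhds (L.localMap_mem_target hz))).of_le
        le_top) (L.contDiffAt_localMap hz) fun j => ?_
    exact ((L.contDiffAt_localMap hz).fderiv_right (m := ∞) (by simp)).clm_apply contDiffAt_const
  have hN0 : N z₀ ≠ 0 := by
    rw [← squaredPhase_ne_zero_iff, hN z₀ hz, phase, squaredPhase_ne_zero_iff]
    exact L.volAt_frame_ne_zero _ _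
  have hchart : ContMDiffAt ((𝓡 n).prod 𝓘(ℝ, ℝ)) 𝓘(ℝ, EuclideanSpace ℝ (Fin n) × ℝ) ∞
      (fun x : ℓ × ℝ => (extChartAt (𝓡 n) q x.1, x.2)) (q, t) := by
    rw [modelWithCornersSelf_prod, ← chartedSpaceSelf_prod]
    exact (ContMDiffAt.comp (q, t) (contMDiffAt_extChartAt) contMDiffAt_fst).prodMk
      contMDiffAt_snd
  have hcomp := ContDiffAt.comp_contMDiffAt (f := fun x : ℓ × ℝ => (extChartAt (𝓡 n) q x.1, x.2))
    (x := (q, t)) ((contDiffAt_squaredPhase hN0).comp z₀ hNs) hchart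
  refine hcomp.congr_of_eventuallyEq ?_
  have h1 : ∀ᶠ x : ℓ × ℝ in 𝓝 (q, t), (extChartAt (𝓡 n) q x.1, x.2) ∈ L.localDomain q y :=
    hchart.continuousAt.eventually_mem ((L.isOpen_localDomain q y).mem_nhds hz)
  have h2 : ∀ᶠ x : ℓ × ℝ in 𝓝 (q, t), x.1 ∈ (extChartAt (𝓡 n) q).source :=
    continuousAt_fst.eventually_mem (extChartAt_source_mem_nhds q)
  filter_upwards [h1, h2] with x hx1 hx2
  change _ = squaredPhase (N (extChartAt (𝓡 n) q x.1, x.2))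
  rw [hN _ hx1, (extChartAt (𝓡 n) q).left_inv hx2]

/-- A grading of one fibre and a grading of the base curve determine a grading of `L`. -/
theorem exists_isGrading [FiniteDimensional ℂ E] [IsManifold (𝓡 n) ∞ ℓ] {t₀ : ℝ} {a : ℓ → ℝ}
    (ha : L.IsFiberGrading t₀ a) {b : ℝ → ℝ} (hb : L.IsBaseGrading b) :
    ∃ α : ℓ × ℝ → ℝ, L.IsGrading α ∧ ∀ q, α (q, t₀) = a q + b t₀ := by
  have hs := L.contMDiff_phase
  obtain ⟨α, hα, hα0, hαl⟩ := exists_continuous_phase_lift (M := ℓ) (t₀ := t₀)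
    (N := fun x => X.volAt (L.map x) (L.frame x.1 x.2)) (a := fun q => a q + b t₀)
    (fun x => L.volAt_frame_ne_zero x.1 x.2) hs.continuous
    (ha.smooth.continuous.add continuous_const) (fun q => by
      rw [L.volAt_frame, squaredPhase_mul, ← (L.isSquaredPhase_fiber_iff q t₀ _).1 (ha.lift q),
        ← (L.isSquaredPhase_base_iff t₀ _).1 (hb.lift t₀), ← Complex.exp_add]
      push_cast
      ring_nf)
  exact ⟨α, ⟨contMDiff_of_exp_eq hs hα hαl, fun q t =>
    (L.isSquaredPhase_tangent_iff q t _).2 (hαl (q, t))⟩, hα0⟩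

end FiberedLagrangian

/-! ### Additivity of the degree -/

/-- Frames of the tangent spaces of a fibered Lagrangian and of its fibre at a given point, with the
squared phases given by gradings. -/
theorem FiberedLagrangian.exists_frame_at {n : ℕ} {E Y : Type*} [NormedAddCommGroup E]
    [NormedSpace ℂ E] [TopologicalSpace Y] [ChartedSpace E Y] [IsManifold 𝓘(ℂ, E) ω Y]
    {X : KahlerLGModel n E Y} {ℓ : Type*} [TopologicalSpace ℓ]
    [ChartedSpace (EuclideanSpace ℝ (Fin n)) ℓ] [IsManifold (𝓡 n) ∞ ℓ]
    (L : FiberedLagrangian X ℓ) {p : Y} {q : ℓ} {t : ℝ} (hp : L.map (q, t) = p) {a : ℓ → ℝ}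
    (ha : L.IsFiberGrading t a) :
    ∃ (u : Fin n → X.Vert p) (h : E), LinearIndependent ℝ u ∧
      (∀ j k, X.fiberBilin p (u j) (u k) = 0) ∧ X.IsHorizontal p h ∧ X.dv p h = deriv L.γ t ∧
      Submodule.span ℝ (Set.range u) = X.vertPart p (L.fiberTangent q t) ∧
      Submodule.span ℝ (Set.range (KahlerLGModel.extendFrame u h)) = L.tangent q t ∧
      Complex.exp (2 * Real.pi * Complex.I * a q) = squaredPhase (X.fiberVol p u) := by
  subst hp
  exact ⟨L.vertFrame q t, L.horizontalLift q t, L.linearIndependent_vertFrame q t,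
    L.isotropic_vertFrame q t, L.isHorizontal_horizontalLift q t, L.dv_horizontalLift q t,
    L.span_vertFrame q t, L.span_frame q t, (L.isSquaredPhase_fiber_iff q t _).1 (ha.lift q)⟩

theorem vertPart_inf_eq_bot {n : ℕ} {E Y : Type*} [NormedAddCommGroup E] [NormedSpace ℂ E]
    [TopologicalSpace Y] [ChartedSpace E Y] (X : KahlerLGModel n E Y) (p : Y)
    {Λ₀ Λ₁ : Submodule ℝ E} (h : Λ₀ ⊓ Λ₁ = ⊥) : X.vertPart p Λ₀ ⊓ X.vertPart p Λ₁ = ⊥ := by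
  rw [eq_bot_iff]
  intro u hu
  have hmem : (u : E) ∈ Λ₀ ⊓ Λ₁ := ⟨hu.1, hu.2⟩
  rw [h, Submodule.mem_bot] at hmem
  exact (Submodule.mem_bot ℝ).2 (Subtype.ext hmem)

/-- The degree of a transverse pair of real lines in `ℂ` with phase lifts. -/
theorem exists_isFloerDegree_line {x y : ℂ} (hx : x ≠ 0) (hy : y ≠ 0)
    (hxy : Submodule.span ℝ {x} ⊓ Submodule.span ℝ {y} = ⊥) {φ ψ : ℝ}
    (hφ : Complex.exp (2 * Real.pi * Complex.I * φ) = squaredPhase x)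
    (hψ : Complex.exp (2 * Real.pi * Complex.I * ψ) = squaredPhase y) :
    ∃ d : ℤ, IsFloerDegree (fun u w => areaBilin u w) dzForm (Submodule.span ℝ {x})
      (Submodule.span ℝ {y}) φ ψ d := by
  have h := exists_isFloerDegree isKahlerForm_areaBilin (m := 1) (by simp) dzForm_ne_zero
    (v := fun _ => x) (w := fun _ => y) (LinearIndependent.of_subsingleton 0 hx)
    (LinearIndependent.of_subsingleton 0 hy) (fun _ _ => isKahlerForm_areaBilin.self_eq_zero x)
    (fun _ _ => isKahlerForm_areaBilin.self_eq_zero y) (φ₀ := φ) (φ₁ := ψ)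
  simp only [Set.range_const, dzForm_apply] at h
  exact h hxy hφ hψ

end

theorem theorem3 {n : ℕ} {E Y : Type*} [NormedAddCommGroup E] [NormedSpace ℂ E]
    [FiniteDimensional ℂ E] [TopologicalSpace Y] [T2Space Y] [SecondCountableTopology Y]
    [ChartedSpace E Y] [IsManifold 𝓘(ℂ, E) ω Y] (X : KahlerLGModel n E Y)
    {ℓ₀ : Type*} [TopologicalSpace ℓ₀] [ChartedSpace (EuclideanSpace ℝ (Fin n)) ℓ₀]
    [IsManifold (𝓡 n) ∞ ℓ₀]
    {ℓ₁ : Type*} [TopologicalSpace ℓ₁] [ChartedSpace (EuclideanSpace ℝ (Fin n)) ℓ₁]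
    [IsManifold (𝓡 n) ∞ ℓ₁]
    (L₀ : FiberedLagrangian X ℓ₀) (L₁ : FiberedLagrangian X ℓ₁)
    (p : Y) (q₀ : ℓ₀) (t₀ : ℝ) (q₁ : ℓ₁) (t₁ : ℝ)
    (hp₀ : L₀.map (q₀, t₀) = p) (hp₁ : L₁.map (q₁, t₁) = p)
    (fiber_transverse : L₀.fiberTangent q₀ t₀ ⊓ L₁.fiberTangent q₁ t₁ = ⊥)
    (base_transverse : L₀.baseTangent t₀ ⊓ L₁.baseTangent t₁ = ⊥)
    (a₀ : ℓ₀ → ℝ) (ha₀ : L₀.IsFiberGrading t₀ a₀)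
    (a₁ : ℓ₁ → ℝ) (ha₁ : L₁.IsFiberGrading t₁ a₁) :
    (∃ b₀, L₀.IsBaseGrading b₀) ∧ (∃ b₁, L₁.IsBaseGrading b₁) ∧
    ∀ b₀ b₁ : ℝ → ℝ, L₀.IsBaseGrading b₀ → L₁.IsBaseGrading b₁ →
      ∃ (α₀ : ℓ₀ × ℝ → ℝ) (α₁ : ℓ₁ × ℝ → ℝ),
        L₀.IsGrading α₀ ∧ L₁.IsGrading α₁ ∧
        (∀ q, α₀ (q, t₀) = a₀ q + b₀ t₀) ∧ (∀ q, α₁ (q, t₁) = a₁ q + b₁ t₁) ∧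
        ∃ d dFiber dBase : ℤ,
          IsFloerDegree (X.symp p) (X.volAt p) (L₀.tangent q₀ t₀) (L₁.tangent q₁ t₁)
            (α₀ (q₀, t₀)) (α₁ (q₁, t₁)) d ∧
          IsFloerDegree (X.fiberSymp p) (X.fiberVol p)
            (X.vertPart p (L₀.fiberTangent q₀ t₀)) (X.vertPart p (L₁.fiberTangent q₁ t₁))
            (a₀ q₀) (a₁ q₁) dFiber ∧
          IsFloerDegree areaForm dzForm (L₀.baseTangent t₀) (L₁.baseTangent t₁)
            (b₀ t₀) (b₁ t₁) dBase ∧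
          d = dFiber + dBase := by
  refine ⟨L₀.exists_isBaseGrading, L₁.exists_isBaseGrading, fun b₀ b₁ hb₀ hb₁ => ?_⟩
  obtain ⟨α₀, hα₀, hα₀t⟩ := L₀.exists_isGrading ha₀ hb₀
  obtain ⟨α₁, hα₁, hα₁t⟩ := L₁.exists_isGrading ha₁ hb₁
  refine ⟨α₀, α₁, hα₀, hα₁, hα₀t, hα₁t, ?_⟩
  obtain ⟨u₀, h₀, hu₀, hiso₀, hh₀, hdv₀, hs₀, hT₀, hφ₀⟩ := L₀.exists_frame_at hp₀ ha₀
  obtain ⟨u₁, h₁, hu₁, hiso₁, hh₁, hdv₁, hs₁, hT₁, hφ₁⟩ := L₁.exists_frame_at hp₁ ha₁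
  have hd₀ : X.dv p h₀ ≠ 0 := hdv₀ ▸ L₀.γ_immersion t₀
  have hd₁ : X.dv p h₁ ≠ 0 := hdv₁ ▸ L₁.γ_immersion t₁
  have hvol : X.fiberVol p ≠ 0 := by
    intro h
    rw [h, AlternatingMap.zero_apply] at hφ₀
    exact squaredPhase_ne_zero_iff.1 (hφ₀ ▸ Complex.exp_ne_zero _) rfl
  have hdv : X.dv p ≠ 0 := fun h => hd₀ (by rw [h]; rfl)
  have hB₀ : L₀.baseTangent t₀ = Submodule.span ℝ {X.dv p h₀} := by rw [hdv₀]; rfl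
  have hB₁ : L₁.baseTangent t₁ = Submodule.span ℝ {X.dv p h₁} := by rw [hdv₁]; rfl
  obtain ⟨dF, hF⟩ := exists_isFloerDegree (X.isKahlerForm_fiberBilin p)
    (KahlerLGModel.finrank_vert hdv) hvol hu₀ hu₁ hiso₀ hiso₁
    (by rw [hs₀, hs₁]; exact vertPart_inf_eq_bot X p fiber_transverse) hφ₀ hφ₁
  obtain ⟨dB, hB⟩ := exists_isFloerDegree_line hd₀ hd₁ (by rw [← hB₀, ← hB₁, base_transverse])
    (by rw [hdv₀]; exact (L₀.isSquaredPhase_base_iff t₀ _).1 (hb₀.lift t₀))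
    (by rw [hdv₁]; exact (L₁.isSquaredPhase_base_iff t₁ _).1 (hb₁.lift t₁))
  obtain ⟨A, θ, hA, hθ⟩ := hF.exists_lift
  obtain ⟨B, ϑ, hBf, hϑ⟩ := hB.exists_lift
  obtain ⟨C, hC, hCθ⟩ := KahlerLGModel.exists_isPhaseLift_add hh₀ hh₁ hd₀ hA hBf hθ hϑ
  have hTot : IsFloerDegree (fun u w => X.sympBilin p u w) (X.volAt p) (L₀.tangent q₀ t₀)
      (L₁.tangent q₁ t₁) (α₀ (q₀, t₀)) (α₁ (q₁, t₁)) (dF + dB) := by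
    rw [← hT₀, ← hT₁, hα₀t, hα₁t]
    refine ⟨⟨C, _, hC, hCθ⟩, fun A' θ' hA' hθ' => ?_⟩
    have hend := hCθ.end_eq (X.isKahlerForm_sympBilin p) X.dim_eq (X.volAt_ne_zero p) hC hA' hθ'
    rw [Int.cast_add, hF.eq A θ hA hθ, hB.eq B ϑ hBf hϑ, ← hend, hθ'.start, hθ.start, hϑ.start]
    ring
  rw [hs₀, hs₁] at hF
  rw [← hB₀, ← hB₁] at hB
  exact ⟨dF + dB, dF, dB, hTot, hF, hB, rfl⟩
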